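/- A ranking over a finite set $C$ of candidates is a linear order of $C$; write $x\prec_\pi y$ if $x$ is before $y$ in the ranking $\pi$. The Kendall tau distance of two rankings $\pi,\pi'$ over $C$ is $$\mathrm{KT}(\pi,\pi')=\bigl|\{\{x,y\}\subseteq C : (x\prec_\pi y\wedge y\prec_{\pi'}x)\vee(y\prec_\pi x\wedge x\prec_{\pi'}y)\}\bigr|.$$ The problem \$-Bribery-Kemeny Score is the following. Input: a finite set $C$ of candidates, a tuple $(R_1,\dots,R_n)$ of rankings over $C$ (repetitions allowed), a ranking $X$ over $C$, costs $\mathrm{cost}(R_1),\dots,\mathrm{cost}(R_n)\in\mathbb N$, a budget $\mathrm{bgt}\in\mathbb N$ and an integer $k$, where all numbers are written in binary. Question: are there a set $S\subseteq\{1,\dots,n\}$ with $\sum_{i\in S}\mathrm{cost}(R_i)\le\mathrm{bgt}$ and rankings $R_1',\dots,R_n'$ over $C$ with $R_i'=R_i$ for all $i\notin S$ (the rankings with $i\in S$ may be changed arbitrarily) such that $\sum_{i=1}^n\mathrm{KT}(X,R_i')\le k$? **Theorem.** \$-Bribery-Kemeny Score can be solved in polynomial time: there are a deterministic (multi-stack)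 Turing machine and a polynomial $p$ such that, on the code of any input, of length $\ell$, the machine halts after at most $p(\ell)$ steps with the correct yes/no answer. -/

import Mathlib

/-- A ranking of the candidates `0, …, m - 1`: `π i` is the candidate in position `i`. -/
abbrev Ranking (m : ℕ) : Type := Equiv.Perm (Fin m)

/-- `x ≺_π y`: the candidate `x` is before the candidate `y` in the ranking `π`. -/
def Ranking.Before {m : ℕ} (π : Ranking m) (x y : Fin m) : Prop :=
  π.symm x < π.symm y

open Classical in
/-- The Kendall tau distance: the number of pairs `{x, y}` of candidates whose relative order
differs in `π` and `π'`. -/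
noncomputable def kendallTau {m : ℕ} (π π' : Ranking m) : ℕ :=
  (Finset.univ.filter fun s : Finset (Fin m) =>
    ∃ x y : Fin m, s = {x, y} ∧
      ((Ranking.Before π x y ∧ Ranking.Before π' y x) ∨
        (Ranking.Before π y x ∧ Ranking.Before π' x y))).card

/-- The Kendall tau distance of a ranking from a tuple of rankings. -/
noncomputable def totalKendallTau {m n : ℕ} (X : Ranking m) (R : Fin n → Ranking m) : ℕ :=
  ∑ i, kendallTau X (R i)

/-- An input of the problem: a candidate set `{0, …, m - 1}`, a tuple of `n` rankings (repetitions
are allowed), a ranking `X`, a price for every ranking of the tuple, a budget and an integer. -/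
structure DollarBribery where
  /-- number of candidates -/
  m : ℕ
  /-- number of rankings -/
  n : ℕ
  /-- the given rankings -/
  R : Fin n → Ranking m
  /-- the distinguished ranking -/
  X : Ranking m
  /-- the price of changing each ranking -/
  cost : Fin n → ℕ
  /-- the budget -/
  bgt : ℕ
  /-- the bound on the total distance -/
  k : ℤ

/-- The question: can a set `S` of the rankings, of total price at most the budget, be replaced by
arbitrary rankings so that the total distance of `X` from the new tuple is at most `k`? -/
def DollarBribery.IsYes (I : DollarBribery) : Prop :=
  ∃ (S : Finset (Fin I.n)) (R' : Fin I.n → Ranking I.m),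
    (∀ i, i ∉ S → R' i = I.R i) ∧ ∑ i ∈ S, I.cost i ≤ I.bgt ∧
      (totalKendallTau I.X R' : ℤ) ≤ I.k

namespace KemenyEncoding

/-- The input alphabet: two bits and two delimiters. -/
inductive Letter where
  | bit (b : Bool)
  | comma
  | semicolon
  deriving DecidableEq, Fintype

/-- A natural number: its binary digits (least significant digit first), closed by a comma. -/
def encNat (a : ℕ) : List Letter :=
  (Computability.encodeNat a).map Letter.bit ++ [Letter.comma]

/-- An integer: one bit that tells whether it is negative, then the absolute value in binary. -/
def encInt (a : ℤ) : List Letter :=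
  Letter.bit (decide (a < 0)) :: encNat a.natAbs

/-- A list of natural numbers, closed by a semicolon. -/
def encList (l : List ℕ) : List Letter :=
  l.flatMap encNat ++ [Letter.semicolon]

/-- The candidates in the order of the ranking. -/
def rankingList {m : ℕ} (π : Ranking m) : List ℕ :=
  List.ofFn fun i => (π i : ℕ)

/-- The encoding of an input: `X`, the budget and `k`, then every ranking with its price. All
numbers are written in binary. The candidate set is the set of entries of `X`. -/
def encode (I : DollarBribery) : List Letter :=
  encList (rankingList I.X) ++ (encNat I.bgt ++ (encInt I.k ++
    (List.ofFn fun i => (rankingList (I.R i), I.cost i)).flatMap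
      fun p => encList p.1 ++ encNat p.2))

theorem encNat_append_inj {a b : ℕ} {u v : List Letter}
    (h : encNat a ++ u = encNat b ++ v) : a = b ∧ u = v := by
  have key : ∀ (p q : List Bool), p.map Letter.bit ++ [Letter.comma] ++ u
      = q.map Letter.bit ++ [Letter.comma] ++ v → p = q ∧ u = v := by
    intro p
    induction p with
    | nil => intro q hq; cases q <;> simp_all
    | cons x p ih =>
      intro q hq
      cases q with
      | nil => simp at hq
      | cons y q =>
        simp only [List.map_cons, List.cons_append, List.cons.injEq, Letter.bit.injEq] at hq
        obtain ⟨h1, h2⟩ := ih q hq.2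
        exact ⟨by rw [hq.1, h1], h2⟩
  obtain ⟨h1, h2⟩ := key _ _ h
  refine ⟨?_, h2⟩
  rw [← Computability.decode_encodeNat a, h1, Computability.decode_encodeNat]

theorem encNat_append_ne_semicolon (a : ℕ) (u v : List Letter) :
    encNat a ++ u ≠ Letter.semicolon :: v := by
  unfold encNat
  cases Computability.encodeNat a <;> simp

theorem encInt_append_inj {a b : ℤ} {u v : List Letter}
    (h : encInt a ++ u = encInt b ++ v) : a = b ∧ u = v := by
  simp only [encInt, List.cons_append, List.cons.injEq, Letter.bit.injEq, decide_eq_decide] at h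
  obtain ⟨h1, h2⟩ := encNat_append_inj h.2
  exact ⟨by have := h.1; omega, h2⟩

theorem encList_append_inj {l l' : List ℕ} {u v : List Letter}
    (h : encList l ++ u = encList l' ++ v) : l = l' ∧ u = v := by
  induction l generalizing l' with
  | nil =>
    cases l' with
    | nil => simpa [encList] using h
    | cons b l' =>
      simp only [encList, List.flatMap_nil, List.flatMap_cons, List.append_assoc,
        List.nil_append, List.singleton_append] at h
      exact absurd h.symm (encNat_append_ne_semicolon _ _ _)
  | cons a l ih =>
    cases l' with
    | nil =>
      simp only [encList, List.flatMap_nil, List.flatMap_cons, List.append_assoc,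
        List.nil_append, List.singleton_append] at h
      exact absurd h (encNat_append_ne_semicolon _ _ _)
    | cons b l' =>
      simp only [encList, List.flatMap_cons, List.append_assoc] at h
      obtain ⟨h1, h2⟩ := encNat_append_inj h
      obtain ⟨h3, h4⟩ := ih (l' := l') (by simpa [encList] using h2)
      exact ⟨by rw [h1, h3], h4⟩

theorem voters_inj {l l' : List (List ℕ × ℕ)}
    (h : l.flatMap (fun p => encList p.1 ++ encNat p.2)
      = l'.flatMap (fun p => encList p.1 ++ encNat p.2)) : l = l' := by
  induction l generalizing l' with
  | nil => cases l' <;> simp_all [encList]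
  | cons a l ih =>
    cases l' with
    | nil => simp [encList] at h
    | cons b l' =>
      simp only [List.flatMap_cons, List.append_assoc] at h
      obtain ⟨h1, h2⟩ := encList_append_inj h
      obtain ⟨h3, h4⟩ := encNat_append_inj h2
      rw [ih h4, Prod.ext h1 h3]

theorem rankingList_inj {m : ℕ} {π π' : Ranking m} (h : rankingList π = rankingList π') :
    π = π' := by
  have := List.ofFn_injective h
  exact Equiv.ext fun i => Fin.ext (congrFun this i)

/-- Different inputs have different codes. -/
theorem encode_injective : Function.Injective encode := by
  rintro ⟨m, n, R, X, c, b, k⟩ ⟨m', n', R', X', c', b', k'⟩ h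
  simp only [encode] at h
  obtain ⟨h1, hb⟩ := encList_append_inj h
  obtain ⟨rfl, hk⟩ := encNat_append_inj hb
  obtain ⟨rfl, hv⟩ := encInt_append_inj hk
  have hl := voters_inj hv
  have hm : m = m' := by simpa [rankingList] using congrArg List.length h1
  have hn : n = n' := by simpa using congrArg List.length hl
  subst hm hn
  have h2 := List.ofFn_injective hl
  obtain rfl := rankingList_inj h1
  have hR : R = R' := funext fun i => rankingList_inj (congrArg Prod.fst (congrFun h2 i))
  have hc : c = c' := funext fun i => congrArg Prod.snd (congrFun h2 i)
  rw [hR, hc]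

end KemenyEncoding

open Classical in
/-- The decision problem `P`, with inputs written by `enc` over a finite alphabet, can be solved in
polynomial time: one Turing machine answers every input correctly, within a number of steps that is
bounded by a fixed polynomial in the length of the code of the input. -/
def SolvableInPolyTime {α Γ : Type} [Fintype Γ] (enc : α → List Γ) (P : α → Prop) : Prop :=
  Nonempty (Turing.TM2ComputableInPolyTime enc Computability.encodeBool fun a => decide (P a))

/-! If a ranking is changed at all, it is best changed to `X` itself, which has distance 0 and costs
the same as any other change (`DollarBribery.isYes_iff`). So only a subset has to be chosen: each
voter either costs its price or contributes its distance from `X`. This is a knapsack problem whose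
prices may be exponentially large, but whose distances add up to at most n·m². The dynamic program
`table` is therefore indexed by the allowed distance and stores least prices, capped at `bgt + 1`.
Beyond the end of the table all rankings can be kept, so the least price there is 0; this settles
every bound `k` written in binary, however large. `getD_table_le_iff` is the correctness of the
table, and `solve_encode_iff` adds the correctness of the parser.

The time bound is about actual `Turing.TM2` machines. Structured stack programs are compiled to
machine code (`code`), and `Run` is a compositional specification with a step count. Data are binary
trees written in prefix notation on one stack. `PolyTime f` says that a program replaces the word of
`a` by that of `f a` with polynomial bounds on time and output size. It is closed under composition,
pairing, case distinction and folds whose steps add only a polynomial amount to the size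
(`foldl_of_step_le`), so `fun_prop` can derive `polyTime_solve` from the definition of the
algorithm. `PolyTime.solvable` attaches the conversion of input and output. -/

/-! ### Stack programs, their machine code and rules for their runs. -/

/-- Structured programs on stacks: `loop k again body` pops the stack `k`, runs the body that
belongs to the popped symbol, and starts anew if `again` holds for this symbol. -/
inductive StackProg {K : Type} (Γ : K → Type) : Type where
  | skip : StackProg Γ
  | push (k : K) (a : Γ k) : StackProg Γ
  | seq (p q : StackProg Γ) : StackProg Γ
  | loop (k : K) (again : Option (Γ k) → Bool) (body : Option (Γ k) → StackProg Γ) : StackProg Γ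

namespace StackProg

variable {K : Type} {Γ : K → Type}

/-- The labels of the machine code of a program. -/
def Label : StackProg Γ → Type
  | skip => Unit
  | push _ _ => Unit
  | seq p q => Label p ⊕ Label q
  | loop _ _ body => Option (Σ o, Label (body o))

/-- The label at which the machine code of a program is entered. -/
def entry : (p : StackProg Γ) → Label p
  | skip => ()
  | push _ _ => ()
  | seq p _ => Sum.inl (entry p)
  | loop _ _ _ => none

theorem finite_label [∀ k, Finite (Γ k)] (p : StackProg Γ) : Finite (Label p) := by
  induction p with
  | skip => exact inferInstanceAs (Finite Unit)
  | push => exact inferInstanceAs (Finite Unit)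
  | seq p q hp hq => exact inferInstanceAs (Finite (Label p ⊕ Label q))
  | loop k again body ih => exact inferInstanceAs (Finite (Option (Σ o, Label (body o))))

variable [DecidableEq K]

/-- The finite memory of the machine: the symbol popped last from each stack. -/
abbrev Memory (Γ : K → Type) : Type := ∀ k, Option (Γ k)

/-- The machine code of a program, with its labels embedded by `emb` into the labels of the whole
machine; when the program is done it jumps to `exit`. -/
def code : (p : StackProg Γ) → {L : Type} → (emb : Label p → L) → (exit : L) → Label p →
    Turing.TM2.Stmt Γ L (Memory Γ)
  | skip, _, _, exit, _ => .goto fun _ => exit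
  | push k a, _, _, exit, _ => .push k (fun _ => a) (.goto fun _ => exit)
  | seq p q, _, emb, _, Sum.inl l =>
    code p (fun l => emb (Sum.inl l)) (emb (Sum.inr (entry q))) l
  | seq _ q, _, emb, exit, Sum.inr l => code q (fun l => emb (Sum.inr l)) exit l
  | loop k _ body, _, emb, _, none =>
    -- The popped symbol is kept in the memory because only a jump can depend on it; each symbol has
    -- its own copy of the labels of its body.
    .pop k (fun v o => Function.update v k o) (.goto fun v => emb (some ⟨v k, entry (body (v k))⟩))
  | loop _ again body, _, emb, exit, some ⟨o, l⟩ =>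
    code (body o) (fun l => emb (some ⟨o, l⟩)) (if again o then emb none else exit) l

/-- `p.Run s s' t`: the program `p`, started with the stacks `s`, stops with the stacks `s'` after
at most `t` machine steps, as a part of any machine. -/
def Run (p : StackProg Γ) (s s' : ∀ k, List (Γ k)) (t : ℕ) : Prop :=
  ∀ (L : Type) (M : L → Turing.TM2.Stmt Γ L (Memory Γ)) (emb : Label p → L) (exit : L),
    (∀ l, M (emb l) = code p emb exit l) → ∀ v, ∃ v' n, n ≤ t ∧
      (flip bind (Turing.TM2.step M))^[n] (some ⟨some (emb (entry p)), v, s⟩)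
        = some ⟨some exit, v', s'⟩

theorem Run.mono {p : StackProg Γ} {s s' : ∀ k, List (Γ k)} {t t' : ℕ} (h : p.Run s s' t)
    (ht : t ≤ t') : p.Run s s' t' := fun L M emb exit hM v =>
  let ⟨v', n, hn, h⟩ := h L M emb exit hM v
  ⟨v', n, hn.trans ht, h⟩

theorem run_skip (s : ∀ k, List (Γ k)) : (skip : StackProg Γ).Run s s 1 := fun L M emb exit hM v =>
  ⟨v, 1, le_rfl, by simp [flip, hM, code]⟩

theorem run_push (k : K) (a : Γ k) (s : ∀ k, List (Γ k)) :
    (push k a).Run s (Function.update s k (a :: s k)) 1 := fun L M emb exit hM v =>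
  ⟨v, 1, le_rfl, by simp [flip, hM, code]⟩

/-- `Run` quantifies over all machines and exits, so the first program can be run with the entry of
the second as its exit. -/
theorem Run.seq {p q : StackProg Γ} {s s₁ s₂ : ∀ k, List (Γ k)} {t₁ t₂ : ℕ}
    (hp : p.Run s s₁ t₁) (hq : q.Run s₁ s₂ t₂) : (p.seq q).Run s s₂ (t₁ + t₂) := by
  intro L M emb exit hM v
  obtain ⟨v₁, n₁, hn₁, h₁⟩ := hp L M (fun l => emb (Sum.inl l)) (emb (Sum.inr (entry q)))
    (fun l => hM (Sum.inl l)) v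
  obtain ⟨v₂, n₂, hn₂, h₂⟩ := hq L M (fun l => emb (Sum.inr l)) exit (fun l => hM (Sum.inr l)) v₁
  refine ⟨v₂, n₂ + n₁, by omega, ?_⟩
  rw [Function.iterate_add_apply]
  erw [h₁, h₂]

/-- One round of a loop, shared by the two rules below; the pop costs one step more than the body.
An empty stack yields `none` and stays empty. -/
theorem run_loop_aux {k : K} {again : Option (Γ k) → Bool} {body : Option (Γ k) → StackProg Γ}
    {s s₁ : ∀ k, List (Γ k)} {t : ℕ}
    (h : (body (s k).head?).Run (Function.update s k (s k).tail) s₁ t)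
    {L : Type} {M : L → Turing.TM2.Stmt Γ L (Memory Γ)} {emb : Label (loop k again body) → L}
    {exit : L} (hM : ∀ l, M (emb l) = code (loop k again body) emb exit l) (v : Memory Γ) :
    ∃ v' n, n ≤ t + 1 ∧
      (flip bind (Turing.TM2.step M))^[n] (some ⟨some (emb (entry (loop k again body))), v, s⟩)
        = some ⟨some (if again (s k).head? then emb none else exit), v', s₁⟩ := by
  obtain ⟨v', n, hn, h⟩ := h L M (fun l => emb (some ⟨(s k).head?, l⟩))
    (if again (s k).head? then emb none else exit) (fun l => hM (some ⟨_, l⟩))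
    (Function.update v k (s k).head?)
  refine ⟨v', n + 1, by omega, ?_⟩
  rw [Function.iterate_add_apply, ← h]
  congr 1
  -- The type of the inner label depends on `o`, so the symbol is exchanged in the whole dependent
  -- pair at once.
  have key : ∀ o, o = (s k).head? → emb (some ⟨o, entry (body o)⟩)
      = emb (some ⟨(s k).head?, entry (body (s k).head?)⟩) := by rintro _ rfl; rfl
  have h₀ := hM none
  simp only [Function.iterate_one, flip, entry, Option.bind_eq_bind, Option.bind_some,
    Turing.TM2.step, h₀, code, Turing.TM2.stepAux, key _ (Function.update_self k _ v)]

theorem Run.loop_stop {k : K} {again : Option (Γ k) → Bool} {body : Option (Γ k) → StackProg Γ}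
    {s s₁ : ∀ k, List (Γ k)} {t : ℕ} (hs : again (s k).head? = false)
    (h : (body (s k).head?).Run (Function.update s k (s k).tail) s₁ t) :
    (loop k again body).Run s s₁ (t + 1) := by
  intro L M emb exit hM v
  simpa [hs] using run_loop_aux h hM v

theorem Run.loop_again {k : K} {again : Option (Γ k) → Bool} {body : Option (Γ k) → StackProg Γ}
    {s s₁ s₂ : ∀ k, List (Γ k)} {t t' : ℕ} (hs : again (s k).head? = true)
    (h : (body (s k).head?).Run (Function.update s k (s k).tail) s₁ t)
    (h' : (loop k again body).Run s₁ s₂ t') :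
    (loop k again body).Run s s₂ (t + 1 + t') := by
  intro L M emb exit hM v
  obtain ⟨v₁, n₁, hn₁, h₁⟩ := run_loop_aux h hM v
  obtain ⟨v₂, n₂, hn₂, h₂⟩ := h' L M emb exit hM v₁
  refine ⟨v₂, n₂ + n₁, by omega, ?_⟩
  rw [Function.iterate_add_apply, h₁]
  simp only [hs, if_true]
  exact h₂

end StackProg

/-! ### Binary trees on the stack of data: reading, dropping, swapping and duplicating. -/

open KemenyEncoding (Letter)

/-- Binary trees, the data on which the machines work. -/
inductive SExpr where
  | nil : SExpr
  | node (l r : SExpr) : SExpr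

/-- The code of a binary tree in prefix notation. -/
def SExpr.code : SExpr → List Bool
  | nil => [false]
  | node l r => true :: (code l ++ code r)

/-- The stacks of the machines: the input, the stack of data, two auxiliary ones and a
counter. -/
inductive StackName where
  | input
  | data
  | left
  | right
  | counter
  deriving DecidableEq

instance : Fintype StackName :=
  ⟨{.input, .data, .left, .right, .counter}, fun k => by cases k <;> decide⟩

/-- The alphabets of the contents. -/
abbrev StackName.Symbol : StackName → Type
  | input => Letter
  | data => Bool
  | left => Bool
  | right => Bool
  | counter => Bool

namespace StackProg

open StackName

/-- The stacks with given contents. -/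
def contents (i : List Letter) (a b c n : List Bool) : ∀ k : StackName, List k.Symbol
  | input => i
  | data => a
  | left => b
  | right => c
  | counter => n

section Contents

variable (i i' : List Letter) (a b c n x : List Bool)

@[simp] theorem contents_input : contents i a b c n input = i := rfl
@[simp] theorem contents_data : contents i a b c n data = a := rfl
@[simp] theorem contents_left : contents i a b c n left = b := rfl
@[simp] theorem contents_right : contents i a b c n right = c := rfl
@[simp] theorem contents_counter : contents i a b c n counter = n := rfl

@[simp] theorem update_contents_input :
    Function.update (contents i a b c n) input i' = contents i' a b c n := by
  funext k; cases k <;> rfl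

@[simp] theorem update_contents_data :
    Function.update (contents i a b c n) data x = contents i x b c n := by
  funext k; cases k <;> rfl

@[simp] theorem update_contents_left :
    Function.update (contents i a b c n) left x = contents i a x c n := by
  funext k; cases k <;> rfl

@[simp] theorem update_contents_right :
    Function.update (contents i a b c n) right x = contents i a b x n := by
  funext k; cases k <;> rfl

@[simp] theorem update_contents_counter :
    Function.update (contents i a b c n) counter x = contents i a b c x := by
  funext k; cases k <;> rfl

end Contents

/-- Programs over the stacks `StackName`. -/
abbrev Prog : Type := StackProg StackName.Symbol

section rules

variable {i i' : List Letter} {a b c n : List Bool}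

theorem run_push_data (x : Bool) :
    (push data x : Prog).Run (contents i a b c n) (contents i (x :: a) b c n) 1 := by
  simpa using run_push (Γ := StackName.Symbol) data x (contents i a b c n)

theorem run_push_left (x : Bool) :
    (push left x : Prog).Run (contents i a b c n) (contents i a (x :: b) c n) 1 := by
  simpa using run_push (Γ := StackName.Symbol) left x (contents i a b c n)

theorem run_push_right (x : Bool) :
    (push right x : Prog).Run (contents i a b c n) (contents i a b (x :: c) n) 1 := by
  simpa using run_push (Γ := StackName.Symbol) right x (contents i a b c n)

theorem run_push_counter (x : Bool) :
    (push counter x : Prog).Run (contents i a b c n) (contents i a b c (x :: n)) 1 := by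
  simpa using run_push (Γ := StackName.Symbol) counter x (contents i a b c n)

/-- Pop a symbol from the stack of data and run the program that belongs to it. -/
def popData (body : Bool → Prog) : Prog :=
  loop data (fun _ => false) fun o => o.elim skip body

theorem run_popData {body : Bool → Prog} {x : Bool} {s : ∀ k : StackName, List k.Symbol} {t : ℕ}
    (h : (body x).Run (contents i a b c n) s t) :
    (popData body).Run (contents i (x :: a) b c n) s (t + 1) :=
  Run.loop_stop rfl (by simpa using h)

/-- Run `body` on every symbol of the stack `left`. -/
def drainLeft (body : Bool → Prog) : Prog :=
  loop left (fun o => o.isSome) fun o => o.elim skip body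

/-- Run `body` on every symbol of the stack `right`. -/
def drainRight (body : Bool → Prog) : Prog :=
  loop right (fun o => o.isSome) fun o => o.elim skip body

/-- The functions `f` and `g` give the contents of `data` and `right` in terms of the symbols
processed so far, latest first. The final 2 pays for the pop that finds the stack empty. -/
theorem run_drainLeft {body : Bool → Prog} {f g : List Bool → List Bool} {t : ℕ}
    (h : ∀ x l b, (body x).Run (contents i (f l) b (g l) n)
      (contents i (f (x :: l)) b (g (x :: l)) n) t) :
    ∀ b l, (drainLeft body).Run (contents i (f l) b (g l) n)
      (contents i (f (b.reverse ++ l)) [] (g (b.reverse ++ l)) n) ((t + 1) * b.length + 2)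
  | [], l => Run.loop_stop rfl (by simpa using run_skip _)
  | x :: b, l => by
    simp only [List.reverse_cons, List.append_assoc, List.singleton_append]
    refine (Run.loop_again (k := left) (t := t) rfl ?_ (run_drainLeft h b (x :: l))).mono ?_
    · simpa using h x l b
    · simp only [List.length_cons]; nlinarith

theorem run_drainRight {body : Bool → Prog} {f g : List Bool → List Bool} {t : ℕ}
    (h : ∀ x l c, (body x).Run (contents i (f l) (g l) c n)
      (contents i (f (x :: l)) (g (x :: l)) c n) t) :
    ∀ c l, (drainRight body).Run (contents i (f l) (g l) c n)
      (contents i (f (c.reverse ++ l)) (g (c.reverse ++ l)) [] n) ((t + 1) * c.length + 2)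
  | [], l => Run.loop_stop rfl (by simpa using run_skip _)
  | x :: c, l => by
    simp only [List.reverse_cons, List.append_assoc, List.singleton_append]
    refine (Run.loop_again (k := right) (t := t) rfl ?_ (run_drainRight h c (x :: l))).mono ?_
    · simpa using h x l c
    · simp only [List.length_cons]; nlinarith

/-- Read trees from the stack of data, as many as the counter says. -/
def readTrees (body : Bool → Prog) : Prog :=
  loop counter (fun o => o.isSome) fun o => o.elim skip fun _ =>
    popData fun x => (body x).seq (cond x ((push counter true).seq (push counter true)) skip)

/-- Prefix notation is self-delimiting. The counter holds in unary the number of trees still to be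
read: `false` completes one of them, `true` replaces one by two. What happens after `t` is read is a
hypothesis, so that the two subtrees can be chained in the induction. A symbol costs at most 5
steps: two pops, the body and two pushes. -/
theorem run_readTrees_cons {body : Bool → Prog} {f g : List Bool → List Bool}
    (h : ∀ x l a n, (body x).Run (contents i a (f l) (g l) n)
      (contents i a (f (x :: l)) (g (x :: l)) n) 1)
    {s : ∀ k : StackName, List k.Symbol} :
    ∀ (t : SExpr) (l a n : List Bool) (T : ℕ),
      (readTrees body).Run (contents i a (f (t.code.reverse ++ l)) (g (t.code.reverse ++ l)) n) s T →
      (readTrees body).Run (contents i (t.code ++ a) (f l) (g l) (true :: n)) s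
        (T + 5 * t.code.length)
  | .nil, l, a, n, T, hT => by
    refine (Run.loop_again (k := counter) rfl ?_ hT).mono (t := 2 + 1 + 1 + T) ?_
    · simpa [SExpr.code] using run_popData ((h false l a n).seq (run_skip _))
    · simp [SExpr.code]; omega
  | .node t₁ t₂, l, a, n, T, hT => by
    have h₂ := run_readTrees_cons h t₂ (t₁.code.reverse ++ true :: l) a n T
      (by simpa [SExpr.code] using hT)
    have h₁ := run_readTrees_cons h t₁ (true :: l) (t₂.code ++ a) (true :: n) _ h₂
    refine (Run.loop_again (k := counter) (t := 1 + (1 + 1) + 1) rfl ?_ h₁).mono ?_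
    · simpa [SExpr.code] using run_popData ((h true l _ n).seq
        ((run_push_counter true).seq (run_push_counter true)))
    · simp [SExpr.code]; omega

/-- Read a tree from the stack of data. -/
def readTree (body : Bool → Prog) : Prog :=
  (push counter true).seq (readTrees body)

theorem run_readTree {body : Bool → Prog} {f g : List Bool → List Bool}
    (h : ∀ x l a n, (body x).Run (contents i a (f l) (g l) n)
      (contents i a (f (x :: l)) (g (x :: l)) n) 1) (t : SExpr) (l a : List Bool) :
    (readTree body).Run (contents i (t.code ++ a) (f l) (g l) [])
      (contents i a (f (t.code.reverse ++ l)) (g (t.code.reverse ++ l)) []) (5 * t.code.length + 3) :=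
  ((run_push_counter true).seq (run_readTrees_cons h t l a [] 2
    (Run.loop_stop rfl (by simpa using run_skip _)))).mono (by omega)

end rules

/-- The stacks with given data and nothing else. -/
abbrev dataStack (a : List Bool) : ∀ k : StackName, List k.Symbol :=
  contents [] a [] [] []

/-- Remove the uppermost tree. -/
def drop : Prog := readTree fun _ => skip

theorem run_drop (t : SExpr) (a : List Bool) :
    drop.Run (dataStack (t.code ++ a)) (dataStack a) (5 * t.code.length + 3) :=
  run_readTree (f := fun _ => []) (g := fun _ => []) (fun _ _ _ _ => run_skip _) t [] a

/-- Exchange the two uppermost trees. -/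
def swap : Prog :=
  ((readTree (fun x => push left x)).seq (readTree (fun x => push right x))).seq
    ((drainLeft (fun x => push data x)).seq (drainRight (fun x => push data x)))

theorem run_swap (t u : SExpr) (a : List Bool) :
    swap.Run (dataStack (t.code ++ (u.code ++ a))) (dataStack (u.code ++ (t.code ++ a)))
      (7 * t.code.length + 7 * u.code.length + 10) := by
  have h₁ := run_readTree (i := []) (f := id) (g := fun _ => [])
    (fun x _ _ _ => run_push_left x) t [] (u.code ++ a)
  have h₂ := run_readTree (i := []) (f := fun _ => t.code.reverse) (g := id)
    (fun x _ _ _ => run_push_right x) u [] a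
  have h₃ := run_drainLeft (i := []) (n := []) (f := id) (g := fun _ => u.code.reverse)
    (fun x _ _ => run_push_data x) t.code.reverse a
  have h₄ := run_drainRight (i := []) (n := []) (f := id) (g := fun _ => [])
    (fun x _ _ => run_push_data x) u.code.reverse (t.code ++ a)
  simp only [id, List.append_nil, List.reverse_reverse, List.length_reverse] at h₁ h₂ h₃ h₄
  exact ((h₁.seq h₂).seq (h₃.seq h₄)).mono (by omega)

/-- Duplicate the uppermost tree. -/
def dup : Prog :=
  ((readTree (fun x => push left x)).seq (drainLeft fun x => (push data x).seq (push right x))).seq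
    -- `right` now has its symbols in the order of `data`; a detour through `left` keeps the second
    -- copy from being reversed.
    ((drainRight (fun x => push left x)).seq (drainLeft (fun x => push data x)))

theorem run_dup (t : SExpr) (a : List Bool) :
    dup.Run (dataStack (t.code ++ a)) (dataStack (t.code ++ (t.code ++ a)))
      (12 * t.code.length + 9) := by
  have h₁ := run_readTree (i := []) (f := id) (g := fun _ => [])
    (fun x _ _ _ => run_push_left x) t [] a
  have h₂ := run_drainLeft (i := []) (n := []) (f := fun l => l ++ a) (g := id)
    (fun x _ _ => (run_push_data x).seq (run_push_right x)) t.code.reverse []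
  have h₃ := run_drainRight (i := []) (n := []) (f := fun _ => t.code ++ a) (g := id)
    (fun x _ _ => run_push_left x) t.code []
  have h₄ := run_drainLeft (i := []) (n := []) (f := id) (g := fun _ => [])
    (fun x _ _ => run_push_data x) t.code.reverse (t.code ++ a)
  simp only [id, List.append_nil, List.nil_append, List.reverse_reverse, List.length_reverse]
    at h₁ h₂ h₃ h₄
  exact ((h₁.seq h₂).seq (h₃.seq h₄)).mono (by omega)

end StackProg

/-! ### Representation of data by trees and its size. -/

/-- Types whose elements are represented by binary trees. -/
class HasSExpr (α : Type) where
  /-- the tree that represents an element -/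
  toSExpr : α → SExpr

section HasSExpr

variable {α β : Type} [HasSExpr α] [HasSExpr β]

instance : HasSExpr SExpr := ⟨id⟩

instance : HasSExpr Unit := ⟨fun _ => .nil⟩

instance : HasSExpr (α × β) := ⟨fun p => .node (HasSExpr.toSExpr p.1) (HasSExpr.toSExpr p.2)⟩

/-- The tree that represents a list. -/
def listToSExpr : List α → SExpr
  | [] => .nil
  | a :: l => .node (HasSExpr.toSExpr a) (listToSExpr l)

instance : HasSExpr (List α) := ⟨listToSExpr⟩

/-- The truth values are represented by trees of the same size. -/
instance : HasSExpr Bool :=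
  ⟨fun b => HasSExpr.toSExpr (cond b ([()], []) ([], [()]) : List Unit × List Unit)⟩

instance : HasSExpr ℕ := ⟨fun n => listToSExpr n.bits⟩

/-- The word that represents an element on a stack. -/
def word (a : α) : List Bool := (HasSExpr.toSExpr a).code

/-- The size of the representation of an element. -/
def wordSize (a : α) : ℕ := (word a).length

theorem word_pair (a : α) (b : β) : word (a, b) = true :: (word a ++ word b) := rfl

theorem word_nil : word ([] : List α) = [false] := rfl

theorem word_cons (a : α) (l : List α) : word (a :: l) = true :: (word a ++ word l) := rfl

@[simp] theorem wordSize_pair (a : α) (b : β) :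
    wordSize (a, b) = wordSize a + wordSize b + 1 := by
  simp [wordSize, word_pair]

@[simp] theorem wordSize_nil : wordSize ([] : List α) = 1 := rfl

@[simp] theorem wordSize_cons (a : α) (l : List α) :
    wordSize (a :: l) = wordSize a + wordSize l + 1 := by
  simp [wordSize, word_cons]

@[simp] theorem wordSize_bool (b : Bool) : wordSize b = 5 := by cases b <;> decide

theorem wordSize_nat (n : ℕ) : wordSize n = 6 * n.size + 1 := by
  have : ∀ l : List Bool, wordSize l = 6 * l.length + 1 := by
    intro l
    induction l with
    | nil => rfl
    | cons b l ih => simp [ih]; omega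
  rw [← Nat.size_eq_bits_len]
  exact this n.bits

theorem wordSize_nat_mono {m n : ℕ} (h : m ≤ n) : wordSize m ≤ wordSize n := by
  have := Nat.size_le_size h
  rw [wordSize_nat, wordSize_nat]
  omega

theorem length_le_wordSize (l : List α) : l.length ≤ wordSize l := by
  induction l with
  | nil => simp
  | cons a l ih => simp; omega

theorem wordSize_le_of_mem {a : α} {l : List α} (h : a ∈ l) : wordSize a ≤ wordSize l := by
  induction l with
  | nil => simp at h
  | cons b l ih =>
    rcases List.mem_cons.1 h with rfl | h
    · simp; omega
    · simp; have := ih h; omega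

theorem wordSize_append (l l' : List α) :
    wordSize (l ++ l') + 1 = wordSize l + wordSize l' := by
  induction l with
  | nil => simp; omega
  | cons a l ih => simp; omega

end HasSExpr

theorem Polynomial.eval_nat_mono (q : Polynomial ℕ) {a b : ℕ} (h : a ≤ b) :
    q.eval a ≤ q.eval b := by
  induction q using Polynomial.induction_on' with
  | add p q hp hq => simpa using add_le_add hp hq
  | monomial n c => simpa using Nat.mul_le_mul_left c (Nat.pow_le_pow_left h n)

/-! ### Polynomial-time functions and their basic closure properties. -/

open StackProg StackName

/-- A function on represented types is computed by a program on the stack of data, within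
polynomially many steps. -/
@[fun_prop]
def PolyTime {α β : Type} [HasSExpr α] [HasSExpr β] (f : α → β) : Prop :=
  -- The size bound is what makes the time of a composition polynomial; the arbitrary `rest` allows
  -- a program to run on top of saved data.
  ∃ (p : Prog) (q : Polynomial ℕ), ∀ a, wordSize (f a) ≤ q.eval (wordSize a) ∧
    ∀ rest, p.Run (dataStack (word a ++ rest)) (dataStack (word (f a) ++ rest))
      (q.eval (wordSize a))

namespace PolyTime

variable {α β γ δ σ : Type} [HasSExpr α] [HasSExpr β] [HasSExpr γ] [HasSExpr δ] [HasSExpr σ]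

theorem of_run {f : α → β} (p : Prog) (q r : Polynomial ℕ)
    (hr : ∀ a, wordSize (f a) ≤ r.eval (wordSize a))
    (hq : ∀ a rest, p.Run (dataStack (word a ++ rest)) (dataStack (word (f a) ++ rest))
      (q.eval (wordSize a))) : PolyTime f :=
  ⟨p, q + r, fun a => ⟨by have := hr a; simp; omega, fun rest => (hq a rest).mono (by simp)⟩⟩

theorem wordSize_le {f : α → β} (h : PolyTime f) :
    ∃ q : Polynomial ℕ, ∀ a, wordSize (f a) ≤ q.eval (wordSize a) :=
  let ⟨_, q, h⟩ := h
  ⟨q, fun a => (h a).1⟩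

@[fun_prop]
protected theorem id : PolyTime (fun a : α => a) :=
  of_run skip 1 Polynomial.X (fun a => by simp) fun a rest => by simpa using run_skip _

@[fun_prop]
theorem comp {g : β → γ} {f : α → β} (hg : PolyTime g) (hf : PolyTime f) :
    PolyTime (fun a => g (f a)) := by
  obtain ⟨pg, qg, hg⟩ := hg
  obtain ⟨pf, qf, hf⟩ := hf
  have key : ∀ a, qg.eval (wordSize (f a)) ≤ (qg.comp qf).eval (wordSize a) := fun a => by
    rw [Polynomial.eval_comp]; exact qg.eval_nat_mono (hf a).1
  exact of_run (pf.seq pg) (qf + qg.comp qf) (qg.comp qf) (fun a => (hg _).1.trans (key a))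
    fun a rest => (((hf a).2 rest).seq ((hg (f a)).2 rest)).mono
      (by rw [Polynomial.eval_add]; exact Nat.add_le_add_left (key a) _)

/-- Functions with the same representation are computed by the same programs. -/
theorem of_word_eq {f : α → β} (hf : PolyTime f) {γ δ : Type} [HasSExpr γ] [HasSExpr δ]
    (g : γ → δ) (e : γ → α) (h₁ : ∀ c, word (e c) = word c) (h₂ : ∀ c, word (f (e c)) = word (g c)) :
    PolyTime g := by
  obtain ⟨p, q, h⟩ := hf
  refine ⟨p, q, fun c => ?_⟩
  have := h (e c)
  simp only [wordSize, h₁, h₂] at this ⊢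
  exact this

@[fun_prop]
theorem prodMk {f : α → β} {g : α → γ} (hf : PolyTime f) (hg : PolyTime g) :
    PolyTime (fun a => (f a, g a)) := by
  obtain ⟨pf, qf, hf⟩ := hf
  obtain ⟨pg, qg, hg⟩ := hg
  -- The second component is computed first because it has to lie below the first; the last push is
  -- the symbol of the node that joins them.
  refine of_run ((dup.seq (pg.seq swap)).seq (pf.seq (push data true)))
    (20 * Polynomial.X + 8 * qg + qf + 20) (qf + qg + 1)
    (fun a => by have := (hf a).1; have := (hg a).1; simp; omega) fun a rest => ?_
  have h := ((run_dup (HasSExpr.toSExpr a) rest).seq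
    (((hg a).2 (word a ++ rest)).seq
      (run_swap (HasSExpr.toSExpr (g a)) (HasSExpr.toSExpr a) rest))).seq
    (((hf a).2 (word (g a) ++ rest)).seq (run_push_data true))
  rw [word_pair, List.cons_append, List.append_assoc]
  refine h.mono ?_
  have := (hg a).1
  simp only [wordSize, word] at this ⊢
  simp
  omega

@[fun_prop]
protected theorem fst : PolyTime (fun p : α × β => p.1) :=
  of_run ((popData fun _ => swap).seq drop) (20 * Polynomial.X + 20) Polynomial.X
    (fun p => by obtain ⟨a, b⟩ := p; simp; omega) fun p rest => by
      obtain ⟨a, b⟩ := p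
      rw [word_pair, List.cons_append, List.append_assoc]
      refine ((run_popData (run_swap (HasSExpr.toSExpr a) (HasSExpr.toSExpr b) rest)).seq
        (run_drop (HasSExpr.toSExpr b) (word a ++ rest))).mono ?_
      have := wordSize_pair a b
      simp only [wordSize, word] at this ⊢
      simp
      omega

@[fun_prop]
protected theorem snd : PolyTime (fun p : α × β => p.2) :=
  of_run (popData fun _ => drop) (20 * Polynomial.X + 20) Polynomial.X
    (fun p => by obtain ⟨a, b⟩ := p; simp; omega) fun p rest => by
      obtain ⟨a, b⟩ := p
      rw [word_pair, List.cons_append, List.append_assoc]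
      refine (run_popData (run_drop (HasSExpr.toSExpr a) (word b ++ rest))).mono ?_
      have := wordSize_pair a b
      simp only [wordSize, word] at this ⊢
      simp
      omega

theorem nil_sexpr : PolyTime (fun _ : α => SExpr.nil) :=
  of_run (drop.seq (push data false)) (5 * Polynomial.X + 4) 1 (fun _ => by simp [wordSize]; rfl)
    fun a rest => ((run_drop (HasSExpr.toSExpr a) rest).seq (run_push_data false)).mono
      (by simp [wordSize, word])

theorem const_sexpr (t : SExpr) : PolyTime (fun _ : α => t) := by
  induction t with
  | nil => exact nil_sexpr
  | node l r hl hr => exact (hl.prodMk hr).of_word_eq _ (fun a => a) (fun _ => rfl) fun _ => rfl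

@[fun_prop]
protected theorem const (b : β) : PolyTime (fun _ : α => b) :=
  (const_sexpr (HasSExpr.toSExpr b)).of_word_eq _ (fun a : α => a) (fun _ => rfl) fun _ => rfl

@[fun_prop]
theorem cons {f : α → β} {g : α → List β} (hf : PolyTime f) (hg : PolyTime g) :
    PolyTime (fun a => f a :: g a) :=
  (hf.prodMk hg).of_word_eq _ (fun a => a) (fun _ => rfl) fun _ => rfl

/-- The program computes `(l a, a)`, so that `a` survives the case distinction. After the node
symbol of the pair, the next symbol tells whether the list is empty. If so, just `a` is left; if
not, two pushes of `true` turn the remaining words into `((b, t), a)`. -/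
theorem listCases {l : α → List β} {f : α → γ} {g : α → β → List β → γ} (hl : PolyTime l)
    (hf : PolyTime f) (hg : PolyTime fun p : α × β × List β => g p.1 p.2.1 p.2.2) :
    PolyTime fun a => match l a with
      | [] => f a
      | b :: t => g a b t := by
  have hg' : PolyTime fun p : (β × List β) × α => g p.2 p.1.1 p.1.2 :=
    hg.comp (f := fun p : (β × List β) × α => (p.2, p.1.1, p.1.2)) (by fun_prop)
  obtain ⟨pl, ql, hl⟩ := hl.prodMk PolyTime.id
  obtain ⟨pf, qf, hf⟩ := hf
  obtain ⟨pg, qg, hg⟩ := hg'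
  refine of_run (pl.seq (popData fun _ => popData fun x =>
      cond x (((push data true).seq (push data true)).seq pg) pf))
    (ql + (qf + qg.comp (ql + 1)) + 5) (qf + qg.comp (ql + 1)) (fun a => ?_) fun a rest => ?_
  · have h₁ := (hl a).1
    have h₂ := (hf a).1
    simp only [Polynomial.eval_add, Polynomial.eval_comp]
    cases h : l a with
    | nil => exact h₂.trans (by omega)
    | cons b t =>
      refine ((hg ((b, t), a)).1.trans (qg.eval_nat_mono ?_)).trans (Nat.le_add_left _ _)
      simp [h] at h₁ ⊢
      omega
  · have h₁ := hl a
    simp only [Polynomial.eval_add, Polynomial.eval_comp]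
    cases h : l a with
    | nil =>
      simp only [h, word_pair, word_nil, List.cons_append, List.nil_append] at h₁
      exact ((h₁.2 rest).seq (run_popData (run_popData ((hf a).2 rest)))).mono (by simp; omega)
    | cons b t =>
      simp only [h, word_pair, word_cons, List.cons_append, List.append_assoc] at h₁
      have h₂ := (hg ((b, t), a)).2 rest
      simp only [word_pair, List.cons_append, List.append_assoc] at h₂
      have h₃ := ((run_push_data true).seq (run_push_data true)).seq h₂
      refine ((h₁.2 rest).seq (run_popData (run_popData (x := true)
        (body := fun x => cond x _ pf) h₃))).mono ?_
      have := qg.eval_nat_mono (a := wordSize ((b, t), a)) (b := ql.eval (wordSize a) + 1)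
        (by have := h₁.1; simp at this ⊢; omega)
      simp only [Polynomial.eval_ofNat, Polynomial.eval_one]
      omega

@[fun_prop]
protected theorem cond {c : α → Bool} {f g : α → β} (hc : PolyTime c) (hf : PolyTime f)
    (hg : PolyTime g) : PolyTime fun a => cond (c a) (f a) (g a) := by
  -- By its representation a truth value is a pair of lists whose first component is nonempty
  -- exactly for `true`.
  have hc' : PolyTime fun a => (cond (c a) ([()], []) ([], [()]) : List Unit × List Unit) :=
    hc.of_word_eq _ (fun a => a) (fun _ => rfl) fun _ => rfl
  refine ((PolyTime.fst.comp hc').listCases hg (g := fun a _ _ => f a) (by fun_prop)).of_word_eq _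
    (fun a => a) (fun _ => rfl) fun a => ?_
  cases c a <;> rfl

/-- The program that runs `p` along the list on top of the stack of data. -/
def foldlProg (p : Prog) : Prog :=
  loop data (fun o => o.getD false) fun o => cond (o.getD false)
    -- The two pushes form `((a, l), d)` from the words of `a`, `l` and `d`; `p` turns it into `(l,
    -- d')`, and removing the node symbol leaves the list on top for the next round.
    (((push data true).seq (push data true)).seq (p.seq (popData fun _ => skip))) skip

/-- `N` bounds the list that remains and `B` every intermediate value, so each round runs `p` on an
argument of size at most `N + B + 1`. -/
theorem run_foldl {step : δ → α → δ} {p : Prog} {q : Polynomial ℕ}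
    (hp : ∀ (a : α) (l : List α) (d : δ) (rest : List Bool),
      p.Run (dataStack (word ((a, l), d) ++ rest)) (dataStack (word (l, step d a) ++ rest))
        (q.eval (wordSize ((a, l), d)))) (N B : ℕ) (rest : List Bool) :
    ∀ (l : List α) (d : δ), wordSize l ≤ N → (∀ i, wordSize ((l.take i).foldl step d) ≤ B) →
      (foldlProg p).Run
        (dataStack (word l ++ (word d ++ rest))) (dataStack (word (l.foldl step d) ++ rest))
        (l.length * (q.eval (N + B + 1) + 5) + 2)
  | [], d, _, _ => (Run.loop_stop rfl (by simpa [word_nil] using run_skip _)).mono (by simp)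
  | a :: l, d, hN, hB => by
    have ih := run_foldl hp N B rest l (step d a) (by simp at hN; omega) fun i => hB (i + 1)
    have h := hp a l d rest
    simp only [word_pair, List.cons_append, List.append_assoc] at h
    refine (Run.loop_again (t := 1 + 1 + (q.eval (N + B + 1) + (1 + 1))) (by simp [word_cons]) ?_
      ih).mono ?_
    · have hq := q.eval_nat_mono (a := wordSize ((a, l), d)) (b := N + B + 1)
        (by have := hB 0; simp at this hN ⊢; omega)
      simpa [word_cons] using ((run_push_data true).seq (run_push_data true)).seq
        ((h.mono hq).seq (run_popData (body := fun _ => skip) (run_skip _)))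
    · simp only [List.length_cons]
      ring_nf
      omega

/-- Closure under recursion along lists, if the intermediate values have polynomial size. -/
theorem foldl {l : γ → List α} {init : γ → σ} {step : γ → σ → α → σ} (hl : PolyTime l)
    (hi : PolyTime init) (hs : PolyTime fun p : γ × σ × α => step p.1 p.2.1 p.2.2)
    (hb : ∃ r : Polynomial ℕ, ∀ x i,
      wordSize (((l x).take i).foldl (step x) (init x)) ≤ r.eval (wordSize x)) :
    PolyTime fun x => (l x).foldl (step x) (init x) := by
  -- The parameter `x` of the step travels along as a second component of the accumulator.
  have hT : PolyTime fun p : (α × List α) × (σ × γ) =>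
      (p.1.2, (step p.2.2 p.2.1 p.1.1, p.2.2)) :=
    prodMk (by fun_prop) (prodMk (hs.comp (f := fun p : (α × List α) × (σ × γ) =>
      (p.2.2, p.2.1, p.1.1)) (by fun_prop)) (by fun_prop))
  have hI : PolyTime fun x => (l x, (init x, x)) := by fun_prop
  obtain ⟨p, q, hp⟩ := hT
  obtain ⟨pi, qi, hpi⟩ := hI
  obtain ⟨r, hr⟩ := hb
  have key : ∀ (x : γ) (l : List α) (s : σ),
      l.foldl (fun (d : σ × γ) a => (step d.2 d.1 a, d.2)) (s, x) = (l.foldl (step x) s, x) := by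
    intro x l
    induction l with
    | nil => intro s; rfl
    | cons a l ih => intro s; exact ih _
  suffices h : PolyTime fun x => ((l x).foldl (step x) (init x), x) from PolyTime.fst.comp h
  refine of_run ((pi.seq (popData fun _ => skip)).seq (foldlProg p))
    (qi + 2 + (qi * (q.comp (qi + (r + Polynomial.X + 1) + 1) + 5) + 2)) (r + Polynomial.X + 1)
    (fun x => ?_) fun x rest => ?_
  · have := hr x (l x).length
    rw [List.take_length] at this
    simp
    omega
  · have h₁ := (hpi x).2 rest
    have hsize := (hpi x).1
    rw [wordSize_pair] at hsize
    rw [word_pair, List.cons_append, List.append_assoc] at h₁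
    have h₂ := run_foldl (step := fun (d : σ × γ) a => (step d.2 d.1 a, d.2)) (p := p) (q := q)
      (fun a l d rest => (hp ((a, l), d)).2 rest) (qi.eval (wordSize x))
      (r.eval (wordSize x) + wordSize x + 1) rest (l x) (init x, x) (by omega)
      (fun i => by rw [key, wordSize_pair]; have := hr x i; omega)
    rw [key] at h₂
    refine ((h₁.seq (run_popData (body := fun _ => skip) (run_skip _))).seq h₂).mono ?_
    simp only [Polynomial.eval_add, Polynomial.eval_mul, Polynomial.eval_comp, Polynomial.eval_X,
      Polynomial.eval_one, Polynomial.eval_ofNat]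
    have := length_le_wordSize (l x)
    gcongr
    all_goals omega

/-- Closure under recursion along lists, if every step adds a polynomial amount to the size. -/
theorem foldl_of_step_le {l : γ → List α} {init : γ → σ} {step : γ → σ → α → σ} (hl : PolyTime l)
    (hi : PolyTime init) (hs : PolyTime fun p : γ × σ × α => step p.1 p.2.1 p.2.2)
    (r : Polynomial ℕ) (hr : ∀ x s, ∀ a ∈ l x,
      wordSize (step x s a) ≤ wordSize s + r.eval (wordSize x)) :
    PolyTime fun x => (l x).foldl (step x) (init x) := by
  obtain ⟨ql, hql⟩ := hl.wordSize_le
  obtain ⟨qi, hqi⟩ := hi.wordSize_le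
  refine hl.foldl hi hs ⟨qi + ql * r, fun x i => ?_⟩
  have key : ∀ (l' : List α) (s : σ), (∀ a ∈ l', a ∈ l x) →
      wordSize (l'.foldl (step x) s) ≤ wordSize s + l'.length * r.eval (wordSize x) := by
    intro l'
    induction l' with
    | nil => intro s _; simp
    | cons a l' ih =>
      intro s h
      have h₁ := ih (step x s a) fun b hb => h b (List.mem_cons_of_mem _ hb)
      have h₂ := hr x s a (h a List.mem_cons_self)
      simp only [List.foldl_cons, List.length_cons, Nat.succ_mul]
      omega
  refine (key ((l x).take i) (init x) fun a ha => List.mem_of_mem_take ha).trans ?_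
  simp only [Polynomial.eval_add, Polynomial.eval_mul]
  have h₁ := length_le_wordSize (l x)
  have h₂ := hql x
  exact add_le_add (hqi x) (Nat.mul_le_mul_right _ (by simp; omega))

end PolyTime

/-! ### Lists, truth values and binary arithmetic in polynomial time. -/

namespace PolyTime

variable {α β γ δ σ : Type} [HasSExpr α] [HasSExpr β] [HasSExpr γ] [HasSExpr δ] [HasSExpr σ]

theorem congr {f g : α → β} (hf : PolyTime f) (h : ∀ a, f a = g a) : PolyTime g :=
  funext h ▸ hf

@[fun_prop]
theorem list_reverse {f : α → List β} (hf : PolyTime f) : PolyTime fun a => (f a).reverse := by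
  suffices h : PolyTime fun l : List β => l.reverse from h.comp hf
  refine (foldl_of_step_le (l := fun l : List β => l) (init := fun _ => [])
    (step := fun _ s b => b :: s) (by fun_prop) (by fun_prop) (by fun_prop) (Polynomial.X + 1)
    fun l s b hb => ?_).congr fun l => by simp
  have := wordSize_le_of_mem hb
  simp
  omega

/-- Closure under recursion along lists from the right. -/
theorem foldr_of_step_le {l : γ → List α} {init : γ → σ} {step : γ → α → σ → σ} (hl : PolyTime l)
    (hi : PolyTime init) (hs : PolyTime fun p : γ × α × σ => step p.1 p.2.1 p.2.2)
    (r : Polynomial ℕ) (hr : ∀ x s, ∀ a ∈ l x,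
      wordSize (step x a s) ≤ wordSize s + r.eval (wordSize x)) :
    PolyTime fun x => (l x).foldr (step x) (init x) :=
  (foldl_of_step_le (l := fun x => (l x).reverse) (step := fun x s a => step x a s)
    (by fun_prop) hi (hs.comp (f := fun p : γ × σ × α => (p.1, p.2.2, p.2.1)) (by fun_prop)) r
    fun x s a ha => hr x s a (by simpa using ha)).congr fun x => by simp

@[fun_prop]
theorem list_append {f g : α → List β} (hf : PolyTime f) (hg : PolyTime g) :
    PolyTime fun a => f a ++ g a := by
  suffices h : PolyTime fun p : List β × List β => p.1 ++ p.2 from h.comp (hf.prodMk hg)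
  refine (foldr_of_step_le (l := fun p : List β × List β => p.1) (init := fun p => p.2)
    (step := fun _ b s => b :: s) (by fun_prop) (by fun_prop) (by fun_prop) (Polynomial.X + 1)
    fun p s b hb => ?_).congr fun p => by simp
  have := wordSize_le_of_mem hb
  have := wordSize_pair p.1 p.2
  simp at this ⊢
  omega

theorem list_flatMap {l : γ → List α} {f : γ → α → List β} (hl : PolyTime l)
    (hf : PolyTime fun p : γ × α => f p.1 p.2) : PolyTime fun x => (l x).flatMap (f x) := by
  obtain ⟨ql, hql⟩ := hl.wordSize_le
  obtain ⟨qf, hqf⟩ := hf.wordSize_le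
  refine (foldr_of_step_le (l := l) (init := fun _ => []) (step := fun x a s => f x a ++ s)
    hl (by fun_prop) ?_ (qf.comp (Polynomial.X + ql + 1)) fun x s a ha => ?_).congr fun x => ?_
  · have := hf.comp (f := fun p : γ × α × List β => (p.1, p.2.1)) (by fun_prop)
    fun_prop
  · have h₁ : wordSize (f x a) ≤ _ := (hqf (x, a)).trans
      (qf.eval_nat_mono (b := wordSize x + ql.eval (wordSize x) + 1)
      (by have := hql x; have := wordSize_le_of_mem ha; simp; omega))
    have := wordSize_append (f x a) s
    simp only [Polynomial.eval_comp, Polynomial.eval_add, Polynomial.eval_X, Polynomial.eval_one]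
    omega
  · induction l x with
    | nil => rfl
    | cons a t ih => simp [ih]

theorem list_map {l : γ → List α} {f : γ → α → β} (hl : PolyTime l)
    (hf : PolyTime fun p : γ × α => f p.1 p.2) : PolyTime fun x => (l x).map (f x) :=
  (list_flatMap (f := fun x a => [f x a]) hl (by fun_prop)).congr fun x => by
    rw [List.map_eq_flatMap]

theorem list_filter {l : γ → List α} {f : γ → α → Bool} (hl : PolyTime l)
    (hf : PolyTime fun p : γ × α => f p.1 p.2) : PolyTime fun x => (l x).filter (f x) :=
  (list_flatMap (f := fun x a => cond (f x a) [a] []) hl (by fun_prop)).congr fun x => by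
    induction l x with
    | nil => rfl
    | cons a t ih => cases h : f x a <;> simp [h, ih]

@[fun_prop]
theorem list_tail {f : α → List β} (hf : PolyTime f) : PolyTime fun a => (f a).tail :=
  (listCases hf (f := fun _ => []) (g := fun _ _ t => t) (by fun_prop) (by fun_prop)).congr
    fun a => by cases f a <;> rfl

@[fun_prop]
theorem list_headD {f : α → List β} {g : α → β} (hf : PolyTime f) (hg : PolyTime g) :
    PolyTime fun a => (f a).headD (g a) :=
  (listCases hf (g := fun _ b _ => b) hg (by fun_prop)).congr fun a => by cases f a <;> rfl

@[fun_prop]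
theorem list_isEmpty {f : α → List β} (hf : PolyTime f) : PolyTime fun a => (f a).isEmpty :=
  (listCases hf (f := fun _ => true) (g := fun _ _ _ => false) (by fun_prop) (by fun_prop)).congr
    fun a => by cases f a <;> rfl

-- A fold along the first list whose accumulator holds the unread part of the second list and the
-- pairs found so far, in reverse order.
@[fun_prop]
theorem list_zip {f : α → List β} {g : α → List γ} (hf : PolyTime f) (hg : PolyTime g) :
    PolyTime fun a => (f a).zip (g a) := by
  suffices h : PolyTime fun p : List β × List γ => p.1.zip p.2 from h.comp (hf.prodMk hg)
  have hs : PolyTime fun p : (List β × List γ) × (List γ × List (β × γ)) × β =>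
      match p.2.1.1 with
        | [] => p.2.1
        | c :: t => (t, (p.2.2, c) :: p.2.1.2) :=
    listCases (l := fun p : (List β × List γ) × (List γ × List (β × γ)) × β => p.2.1.1)
      (f := fun p => p.2.1) (g := fun p c t => (t, (p.2.2, c) :: p.2.1.2)) (by fun_prop)
      (by fun_prop) (by fun_prop)
  have h := foldl_of_step_le (l := fun p : List β × List γ => p.1) (init := fun p => (p.2, []))
    (step := fun _ s b => match s.1 with
      | [] => s
      | c :: t => (t, (b, c) :: s.2)) (by fun_prop) (by fun_prop) hs (Polynomial.X + 2)
    fun p s b hb => by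
      obtain ⟨l, l'⟩ := p
      obtain ⟨s, s'⟩ := s
      have : wordSize b ≤ wordSize l := wordSize_le_of_mem hb
      cases s
      · simp
      · simp; omega
  refine (PolyTime.snd.comp h).list_reverse.congr fun p => ?_
  have key : ∀ (l : List β) (l' : List γ) (s : List (β × γ)),
      (l.foldl (fun (s : List γ × List (β × γ)) b => match s.1 with
        | [] => s
        | c :: t => (t, (b, c) :: s.2)) (l', s)).2 = (l.zip l').reverse ++ s := by
    intro l
    induction l with
    | nil => intro l' s; rfl
    | cons b l ih =>
      intro l' s
      cases l' with
      | nil => simpa using ih [] s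
      | cons c t => simpa using ih t ((b, c) :: s)
  rw [key]
  simp

theorem list_zipWith {l : γ → List α} {l' : γ → List β} {f : γ → α → β → δ} (hl : PolyTime l)
    (hl' : PolyTime l') (hf : PolyTime fun p : γ × α × β => f p.1 p.2.1 p.2.2) :
    PolyTime fun x => (l x).zipWith (f x) (l' x) :=
  (list_map (l := fun x => (l x).zip (l' x)) (f := fun x p => f x p.1 p.2) (by fun_prop) hf).congr
    fun x => by rw [List.zip, List.map_zipWith]

@[fun_prop]
theorem bool_and {f g : α → Bool} (hf : PolyTime f) (hg : PolyTime g) :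
    PolyTime fun a => f a && g a :=
  (PolyTime.cond hf hg (PolyTime.const false)).congr fun a => by cases f a <;> rfl

@[fun_prop]
theorem bool_or {f g : α → Bool} (hf : PolyTime f) (hg : PolyTime g) :
    PolyTime fun a => f a || g a :=
  (PolyTime.cond hf (PolyTime.const true) hg).congr fun a => by cases f a <;> rfl

@[fun_prop]
theorem bool_not {f : α → Bool} (hf : PolyTime f) : PolyTime fun a => !f a :=
  (PolyTime.cond hf (PolyTime.const false) (PolyTime.const true)).congr fun a => by
    cases f a <;> rfl

@[fun_prop]
theorem nat_bits {f : α → ℕ} (hf : PolyTime f) : PolyTime fun a => (f a).bits :=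
  hf.of_word_eq _ (fun a => a) (fun _ => rfl) fun _ => rfl

@[fun_prop]
theorem nat_bodd {f : α → ℕ} (hf : PolyTime f) : PolyTime fun a => (f a).bodd :=
  (list_headD hf.nat_bits (PolyTime.const false)).congr fun a => by
    rw [Nat.bodd_eq_bits_head]; cases (f a).bits <;> rfl

@[fun_prop]
theorem nat_div2 {f : α → ℕ} (hf : PolyTime f) : PolyTime fun a => (f a).div2 :=
  hf.nat_bits.list_tail.of_word_eq _ (fun a => a) (fun _ => rfl) fun a => by
    rw [← Nat.div2_bits_eq_tail]; rfl

theorem nat_eq_zero {f : α → ℕ} (hf : PolyTime f) : PolyTime fun a => decide (f a = 0) :=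
  hf.nat_bits.list_isEmpty.congr fun a => by
    cases h : f a using Nat.binaryRec' with
    | zero => simp
    | bit b n hn =>
      rw [Nat.bits_append_bit n b hn]
      symm
      simp only [List.isEmpty_cons, decide_eq_false_iff_not]
      cases b
      · have : n ≠ 0 := fun h => by simp_all
        simp [Nat.bit_val, this]
      · simp [Nat.bit_val]

@[fun_prop]
theorem nat_bit {f : α → Bool} {g : α → ℕ} (hf : PolyTime f) (hg : PolyTime g) :
    PolyTime fun a => Nat.bit (f a) (g a) := by
  -- `Nat.bits` has no leading zeros, so a zero digit in front of the number 0 must not be stored.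
  have h : PolyTime fun a => cond (!f a && (g a).bits.isEmpty) [] (f a :: (g a).bits) := by
    fun_prop
  refine h.of_word_eq _ (fun a => a) (fun _ => rfl) fun a => ?_
  suffices cond (!f a && (g a).bits.isEmpty) [] (f a :: (g a).bits) = (Nat.bit (f a) (g a)).bits by
    rw [this]; rfl
  by_cases h : g a = 0 → f a = true
  · rw [Nat.bits_append_bit _ _ h]
    have : (!f a && (g a).bits.isEmpty) = false := by
      by_contra h'
      simp only [Bool.not_eq_false, Bool.and_eq_true, Bool.not_eq_eq_eq_not, Bool.not_true,
        List.isEmpty_iff] at h'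
      have h0 : (g a).size = 0 := by rw [← Nat.size_eq_bits_len, h'.2]; rfl
      simp [h (Nat.size_eq_zero.1 h0)] at h'
    rw [this]; rfl
  · push Not at h
    simp [h.1, h.2]

theorem wordSize_bit_le (b : Bool) (n : ℕ) : wordSize (Nat.bit b n) ≤ wordSize n + 6 := by
  rw [wordSize_nat, wordSize_nat]
  by_cases h : Nat.bit b n = 0
  · rw [h]; simp
  · rw [Nat.size_bit h]; omega

theorem wordSize_div2_le (n : ℕ) : wordSize n.div2 ≤ wordSize n :=
  wordSize_nat_mono (by rw [Nat.div2_val]; omega)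

@[fun_prop]
theorem nat_ofBits {f : α → List Bool} (hf : PolyTime f) :
    PolyTime fun a => (f a).foldr Nat.bit 0 := by
  suffices h : PolyTime fun l : List Bool => l.foldr Nat.bit 0 from h.comp hf
  exact foldr_of_step_le (l := fun l : List Bool => l) (init := fun _ => 0)
    (step := fun _ => Nat.bit) (by fun_prop) (by fun_prop) (by fun_prop) 6
    fun _ s b _ => by simpa using wordSize_bit_le b s

theorem foldr_bits (n : ℕ) : n.bits.foldr Nat.bit 0 = n := by
  induction n using Nat.binaryRec' with
  | zero => simp
  | bit b n h ih => rw [Nat.bits_append_bit n b h, List.foldr_cons, ih]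

-- Digits are compared from the least significant one: equal digits keep the verdict so far,
-- different ones replace it by the digit of the second number. If that number has digits left at
-- the end, it is the larger one.
@[fun_prop]
theorem nat_le {f g : α → ℕ} (hf : PolyTime f) (hg : PolyTime g) :
    PolyTime fun a => decide (f a ≤ g a) := by
  suffices h : PolyTime fun p : ℕ × ℕ => decide (p.1 ≤ p.2) from h.comp (hf.prodMk hg)
  have h := foldl_of_step_le (l := fun p : ℕ × ℕ => p.1.bits) (init := fun p => (p.2, true))
    (step := fun _ s b => (s.1.div2, cond (cond b s.1.bodd (!s.1.bodd)) s.2 s.1.bodd))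
    (by fun_prop) (by fun_prop) (by fun_prop) 0 fun p s b _ => by
      have := wordSize_div2_le s.1
      obtain ⟨s, s'⟩ := s
      simp at this ⊢
      omega
  have h' : PolyTime fun s : ℕ × Bool => s.2 || !decide (s.1 = 0) := by
    have := nat_eq_zero (PolyTime.fst (α := ℕ) (β := Bool))
    fun_prop
  refine (h'.comp h).congr fun p => ?_
  have key : ∀ (l : List Bool) (y : ℕ) (r : Bool),
      (fun s : ℕ × Bool => s.2 || !decide (s.1 = 0))
        (l.foldl (fun (s : ℕ × Bool) b =>
          (s.1.div2, cond (cond b s.1.bodd (!s.1.bodd)) s.2 s.1.bodd)) (y, r))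
        = cond r (decide (l.foldr Nat.bit 0 ≤ y)) (decide (l.foldr Nat.bit 0 < y)) := by
    intro l
    induction l with
    | nil => 
      intro y r
      cases r
      · simp only [Bool.false_or, List.foldl_nil, List.foldr_nil, cond_false, Nat.pos_iff_ne_zero]
        by_cases h : y = 0 <;> simp [h]
      · simp
    | cons b l ih =>
      intro y r
      rw [List.foldl_cons, ih, List.foldr_cons, Nat.bit_val]
      have := Nat.bodd_add_div2 y
      generalize y.div2 = z at *
      generalize l.foldr Nat.bit 0 = x at *
      generalize y.bodd = d at *
      cases d <;> cases b <;> cases r <;> simp at this ⊢ <;> omega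
  have := key p.1.bits p.2 true
  rw [foldr_bits] at this
  exact this

@[fun_prop]
theorem nat_eq {f g : α → ℕ} (hf : PolyTime f) (hg : PolyTime g) :
    PolyTime fun a => decide (f a = g a) :=
  (bool_and (hf.nat_le hg) (hg.nat_le hf)).congr fun a => by
    rw [← Bool.decide_and, decide_eq_decide]; omega

@[fun_prop]
theorem nat_min {f g : α → ℕ} (hf : PolyTime f) (hg : PolyTime g) :
    PolyTime fun a => min (f a) (g a) :=
  (PolyTime.cond (hf.nat_le hg) hf hg).congr fun a => by
    rw [Nat.min_def, Bool.cond_decide]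

@[fun_prop]
theorem nat_add {f g : α → ℕ} (hf : PolyTime f) (hg : PolyTime g) :
    PolyTime fun a => f a + g a := by
  suffices h : PolyTime fun p : ℕ × ℕ => p.1 + p.2 from h.comp (hf.prodMk hg)
  -- Schoolbook addition with a carry. The concatenated list of digits is only a clock that runs
  -- long enough for both numbers.
  have h := foldl_of_step_le (l := fun p : ℕ × ℕ => p.1.bits ++ p.2.bits)
    (init := fun p => (p.1, p.2, false, ([] : List Bool)))
    (step := fun _ s _ => (s.1.div2, s.2.1.div2,
      cond s.1.bodd (s.2.1.bodd || s.2.2.1) (s.2.1.bodd && s.2.2.1),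
      cond s.1.bodd (cond s.2.1.bodd s.2.2.1 (!s.2.2.1)) (cond s.2.1.bodd (!s.2.2.1) s.2.2.1)
        :: s.2.2.2)) (by fun_prop) (by fun_prop) (by fun_prop) 6 fun p s b _ => by
      have := wordSize_div2_le s.1
      have := wordSize_div2_le s.2.1
      obtain ⟨x, y, c, l⟩ := s
      simp at *
      omega
  -- The digits of the sum were collected with the most significant one in front, so a left fold
  -- that starts with the last carry rebuilds the number.
  have h' : PolyTime fun s : ℕ × ℕ × Bool × List Bool =>
      s.2.2.2.foldl (fun n b => Nat.bit b n) (Nat.bit s.2.2.1 0) :=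
    foldl_of_step_le (l := fun s : ℕ × ℕ × Bool × List Bool => s.2.2.2)
      (step := fun _ n b => Nat.bit b n) (by fun_prop) (by fun_prop) (by fun_prop) 6
      fun _ s b _ => by simpa using wordSize_bit_le b s
  refine (h'.comp h).congr fun p => ?_
  have key : ∀ (t l : List Bool) (x y : ℕ) (c : Bool), x < 2 ^ t.length → y < 2 ^ t.length →
      (fun s : ℕ × ℕ × Bool × List Bool =>
        s.2.2.2.foldl (fun n b => Nat.bit b n) (Nat.bit s.2.2.1 0))
        (t.foldl (fun (s : ℕ × ℕ × Bool × List Bool) _ => (s.1.div2, s.2.1.div2,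
      cond s.1.bodd (s.2.1.bodd || s.2.2.1) (s.2.1.bodd && s.2.2.1),
      cond s.1.bodd (cond s.2.1.bodd s.2.2.1 (!s.2.2.1)) (cond s.2.1.bodd (!s.2.2.1) s.2.2.1)
        :: s.2.2.2)) (x, y, c, l)) = l.foldl (fun n b => Nat.bit b n) (x + y + c.toNat) := by
    intro t
    induction t with
    | nil =>
      intro l x y c hx hy
      simp at hx hy
      simp [hx, hy, Nat.bit_val]
    | cons _ t ih =>
      intro l x y c hx hy
      have h₁ := Nat.bodd_add_div2 x
      have h₂ := Nat.bodd_add_div2 y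
      rw [List.length_cons, Nat.pow_succ] at hx hy
      rw [List.foldl_cons, ih _ _ _ _ (by simp only; omega) (by simp only; omega), List.foldl_cons,
        Nat.bit_val]
      congr 1
      simp only
      generalize x.div2 = x' at *
      generalize y.div2 = y' at *
      generalize x.bodd = d at *
      generalize y.bodd = e at *
      cases d <;> cases e <;> cases c <;> simp at h₁ h₂ ⊢ <;> omega
  have hx : ∀ n : ℕ, n < 2 ^ n.bits.length := fun n => by
    rw [Nat.size_eq_bits_len]; exact n.lt_size_self
  have := key (p.1.bits ++ p.2.bits) [] p.1 p.2 false
    ((hx _).trans_le (Nat.pow_le_pow_right (by omega) (by simp)))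
    ((hx _).trans_le (Nat.pow_le_pow_right (by omega) (by simp)))
  simpa using this

end PolyTime

/-! ### Input, output and the final machine. -/

/-- A letter, represented by two bits. -/
def letterBits : Letter → Bool × Bool
  | .bit b => (true, b)
  | .comma => (false, true)
  | .semicolon => (false, false)

instance : HasSExpr Letter := ⟨fun a => HasSExpr.toSExpr (letterBits a)⟩

@[simp] theorem wordSize_letter (a : Letter) : wordSize a = 11 := by
  rcases a with (_ | _) | _ | _ <;> decide

theorem wordSize_letters (l : List Letter) : wordSize l = 12 * l.length + 1 := by
  induction l with
  | nil => rfl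
  | cons a l ih => simp [ih]; omega

@[fun_prop]
theorem PolyTime.letterBits {α : Type} [HasSExpr α] {f : α → Letter} (hf : PolyTime f) :
    PolyTime fun a => letterBits (f a) :=
  hf.of_word_eq _ (fun a => a) (fun _ => rfl) fun _ => rfl

namespace StackProg

/-- Push a word on the stack `left`. -/
def pushLeft : List Bool → Prog
  | [] => skip
  | x :: w => (push left x).seq (pushLeft w)

theorem run_pushLeft {i : List Letter} {a c n : List Bool} : ∀ (w b : List Bool),
    (pushLeft w).Run (contents i a b c n) (contents i a (w.reverse ++ b) c n) (w.length + 1)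
  | [], b => by simpa [pushLeft] using run_skip _
  | x :: w, b => by
    have := (run_push_left x).seq (run_pushLeft (i := i) (a := a) (c := c) (n := n) w (x :: b))
    simpa [pushLeft] using this.mono (t' := w.length + 1 + 1) (by omega)

/-- Replace the input by its representation on the stack of data. -/
def readInput : Prog :=
  (loop input (fun o => o.isSome) fun o => o.elim (push left false)
    fun x => pushLeft (true :: word x)).seq (drainLeft fun x => push data x)

theorem run_readInput_loop : ∀ (l : List Letter) (b : List Bool),
    Run (loop input (fun o => o.isSome) fun o => o.elim (push left false)
        fun x => pushLeft (true :: word x) : Prog)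
      (contents l [] b [] []) (contents [] [] ((word l).reverse ++ b) [] []) (14 * l.length + 2)
  | [], b => Run.loop_stop rfl (by simpa [word_nil] using run_push_left _)
  | x :: l, b => by
    have ih := run_readInput_loop l ((true :: word x).reverse ++ b)
    rw [word_cons, ← List.cons_append, List.reverse_append, List.append_assoc]
    refine (Run.loop_again (k := input) (t := 13) rfl ?_ ih).mono ?_
    · have h : (word x).length = 11 := wordSize_letter x
      simpa [h] using run_pushLeft (i := l) (a := []) (c := []) (n := []) (true :: word x) b
    · simp only [List.length_cons]; omega

theorem run_readInput (l : List Letter) :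
    readInput.Run (contents l [] [] [] []) (dataStack (word l)) (38 * l.length + 6) := by
  have h₂ := run_drainLeft (i := []) (n := []) (f := id) (g := fun _ => [])
    (fun x _ _ => run_push_data x) (word l).reverse []
  have hl : (word l).length = 12 * l.length + 1 := wordSize_letters l
  have h₁ := run_readInput_loop l []
  simp only [id, List.append_nil, List.reverse_reverse, List.length_reverse] at h₁ h₂
  exact (h₁.seq h₂).mono (by omega)

/-- Replace the representation of a truth value by a single symbol. -/
def writeOutput : Prog :=
  -- Both truth values have words of five symbols, and the second symbol is the value.
  popData fun _ => popData fun x => popData fun _ => popData fun _ => popData fun _ => push data x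

theorem run_writeOutput (b : Bool) :
    writeOutput.Run (dataStack (word b)) (dataStack [b]) 6 := by
  cases b
  · exact run_popData (run_popData (body := fun x => popData fun _ => popData fun _ =>
      popData fun _ => push data x) (run_popData (run_popData (run_popData (run_push_data false)))))
  · exact run_popData (run_popData (body := fun x => popData fun _ => popData fun _ =>
      popData fun _ => push data x) (run_popData (run_popData (run_popData (run_push_data true)))))

instance (k : StackName) : Fintype k.Symbol := by
  cases k <;> infer_instance

/-- The Turing machine that runs a program on the input and leaves its output on the stack of
data. -/
noncomputable def machine (p : Prog) : Turing.FinTM2 where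
  K := StackName
  k₀ := input
  k₁ := data
  Γ := StackName.Symbol
  Λ := Option (Label p)
  main := some (entry p)
  ΛFin :=
    have := finite_label p
    Fintype.ofFinite _
  σ := Memory StackName.Symbol
  initialState := fun _ => none
  m
    | some l => code p some none l
    -- `Turing.haltList` prescribes the initial memory, so the memory is cleared before halting.
    | none => .load (fun _ _ => none) .halt

theorem initList_machine (p : Prog) (l : List Letter) :
    Turing.initList (machine p) l
      = ⟨some (some (entry p)), fun _ => none, contents l [] [] [] []⟩ := by
  simp only [Turing.initList]
  congr 1
  funext k
  cases k <;> rfl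

theorem haltList_machine (p : Prog) (l : List Bool) :
    Turing.haltList (machine p) l = ⟨none, fun _ => none, dataStack l⟩ := by
  simp only [Turing.haltList]
  congr 1
  funext k
  cases k <;> rfl

theorem Run.outputs {p : Prog} {l : List Letter} {l' : List Bool} {t : ℕ}
    (h : p.Run (contents l [] [] [] []) (dataStack l') t) :
    Nonempty (Turing.TM2OutputsInTime (machine p) l (some l') (t + 1)) := by
  obtain ⟨v, n, hn, h⟩ := h (Option (Label p)) (machine p).m some none (fun _ => rfl) fun _ => none
  refine ⟨⟨⟨1 + n, ?_⟩, (Nat.add_comm 1 n).trans_le (Nat.succ_le_succ hn)⟩⟩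
  rw [initList_machine, Function.iterate_add_apply]
  refine (congrArg ((flip bind (machine p).step)^[1]) h).trans ?_
  exact congrArg some (haltList_machine p l').symm

end StackProg

/-- A decision problem is solvable in polynomial time if the code of an input is mapped to the
answer by a function that satisfies `PolyTime`. -/
theorem PolyTime.solvable {α : Type} {enc : α → List Letter} {P : α → Prop}
    {f : List Letter → Bool} (hf : PolyTime f) (h : ∀ a, f (enc a) = true ↔ P a) :
    SolvableInPolyTime enc P := by
  classical
  obtain ⟨p, q, hp⟩ := hf
  refine ⟨⟨⟨machine ((readInput.seq p).seq writeOutput), Equiv.refl _, Equiv.refl _⟩,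
    38 * Polynomial.X + 6 + q.comp (12 * Polynomial.X + 1) + 6 + 1, fun a => Nonempty.some ?_⟩⟩
  have hl := wordSize_letters (enc a)
  have h₂ := (hp (enc a)).2 []
  simp only [List.append_nil] at h₂
  have h₃ := ((((run_readInput (enc a)).seq h₂).seq (run_writeOutput (f (enc a)))).mono
    (t' := 38 * (enc a).length + 6 + q.eval (12 * (enc a).length + 1) + 6) (by rw [hl])).outputs
  have e₁ : List.map (Equiv.refl Letter).invFun (enc a) = enc a := by simp
  have e₂ : List.map (Equiv.refl Bool).invFun (Computability.encodeBool (decide (P a)))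
      = [f (enc a)] := by
    have : f (enc a) = decide (P a) := by rw [← Bool.coe_iff_coe, h a]; simp
    rw [this]; rfl
  have e₃ : (38 * Polynomial.X + 6 + q.comp (12 * Polynomial.X + 1) + 6 + 1 : Polynomial ℕ).eval
      (enc a).length = 38 * (enc a).length + 6 + q.eval (12 * (enc a).length + 1) + 6 + 1 := by
    simp [Polynomial.eval_comp]
  rw [e₃]
  have h₄ : ∀ (l₁ : List Letter) (l₂ : List Bool), l₁ = enc a → l₂ = [f (enc a)] → Nonempty
      (Turing.TM2OutputsInTime (machine ((readInput.seq p).seq writeOutput)) l₁ (some l₂)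
        (38 * (enc a).length + 6 + q.eval (12 * (enc a).length + 1) + 6 + 1)) := by
    rintro _ _ rfl rfl; exact h₃
  exact h₄ _ _ e₁ e₂

/-! ### The algorithm and its polynomial running time. -/

section Algorithm

variable {α : Type} [HasSExpr α]

/-- Put a letter in front of a text that is split into segments and words. -/
def consLetter (a : Letter) (s : List (List (List Bool))) : List (List (List Bool)) :=
  cond (letterBits a).1
    ((((letterBits a).2 :: (s.headD []).headD []) :: (s.headD []).tail) :: s.tail)
    (cond (letterBits a).2 (([] :: s.headD []) :: s.tail) ([] :: s))

/-- Split a text at the semicolons into segments and these at the commas into words. -/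
def segments (l : List Letter) : List (List (List Bool)) :=
  l.foldr consLetter [[]]

theorem wordSize_consLetter_le (a : Letter) (s : List (List (List Bool))) :
    wordSize (consLetter a s) ≤ wordSize s + 10 := by
  have key : ∀ (β : Type) [HasSExpr β] (t : List (List β)),
      wordSize (t.headD []) + wordSize t.tail ≤ wordSize t + 1 := by
    intro β _ t
    cases t
    · simp
    · simp; omega
  have h₁ := key _ s
  have h₂ := key _ (s.headD [])
  rcases a with b | _ | _ <;> simp only [consLetter, letterBits, cond_true, cond_false,
    wordSize_cons, wordSize_nil, wordSize_bool] <;> omega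

theorem PolyTime.segments {f : α → List Letter} (hf : PolyTime f) :
    PolyTime fun a => segments (f a) := by
  refine PolyTime.comp (g := fun l => _root_.segments l) ?_ hf
  exact foldr_of_step_le (l := fun l : List Letter => l) (init := fun _ => [[]])
    (step := fun _ => consLetter) (by fun_prop) (by fun_prop)
    (by unfold consLetter; fun_prop) 10
    fun _ s a _ => by simpa using wordSize_consLetter_le a s

/-- Whether `x` occurs in the list before `y`. -/
def occursBefore (l : List ℕ) (x y : ℕ) : Bool :=
  l.foldr (fun r s => cond (decide (r = y)) false (cond (decide (r = x)) true s)) false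

@[fun_prop]
theorem PolyTime.occursBefore {f : α → List ℕ} {g h : α → ℕ} (hf : PolyTime f) (hg : PolyTime g)
    (hh : PolyTime h) : PolyTime fun a => occursBefore (f a) (g a) (h a) := by
  refine PolyTime.comp (g := fun p : List ℕ × ℕ × ℕ => _root_.occursBefore p.1 p.2.1 p.2.2) ?_
    (hf.prodMk (hg.prodMk hh))
  exact foldr_of_step_le (l := fun p : List ℕ × ℕ × ℕ => p.1) (init := fun _ => false)
    (step := fun p r s => cond (decide (r = p.2.2)) false (cond (decide (r = p.2.1)) true s))
    (by fun_prop) (by fun_prop) (by fun_prop) 0 fun _ s a _ => by simp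

/-- The second candidates of the pairs on which two lists of candidates disagree. -/
def disagreements (l l' : List ℕ) : List ℕ :=
  l.flatMap fun x => l.filter fun y => occursBefore l x y && occursBefore l' y x

@[fun_prop]
theorem PolyTime.disagreements {f g : α → List ℕ} (hf : PolyTime f) (hg : PolyTime g) :
    PolyTime fun a => disagreements (f a) (g a) := by
  refine PolyTime.comp (g := fun p : List ℕ × List ℕ => _root_.disagreements p.1 p.2) ?_
    (hf.prodMk hg)
  refine list_flatMap (l := fun p : List ℕ × List ℕ => p.1) (f := fun p x => p.1.filter fun y =>
    _root_.occursBefore p.1 x y && _root_.occursBefore p.2 y x) (by fun_prop) ?_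
  exact list_filter (l := fun p : (List ℕ × List ℕ) × ℕ => p.1.1) (f := fun p y =>
    _root_.occursBefore p.1.1 p.2 y && _root_.occursBefore p.1.2 y p.2) (by fun_prop) (by fun_prop)

/-- One step of the dynamic program. The entry at `d` of the table is the least price of reducing
the total distance to at most `d`, or `M` if this is smaller; the entries that are missing are
zero. The new ranking has price `c` and its distance is the length of `w`. -/
def tableStep (M : ℕ) (w : List ℕ) (c : ℕ) (t : List ℕ) : List ℕ :=
  -- On the left the ranking is bought for `c` and `d` stays; on the right it is kept, which shifts
  -- the table by its distance, and `M` marks the entries with `d` below this distance. The zeros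
  -- supply the missing entries of `t`.
  (t ++ w.map fun _ => 0).zipWith (fun a b => min (a + c) b) ((w.map fun _ => M) ++ t)

/-- The entries of the new table are at most those of the second list, thanks to `min`. So a step
adds no more than the size of the new entries `M`, whatever `c` is, and the growth is additive. -/
theorem wordSize_tableStep_le (M : ℕ) (w : List ℕ) (c : ℕ) (t : List ℕ) :
    wordSize (tableStep M w c t) ≤ wordSize t + wordSize (w.map fun _ => M) := by
  have key : ∀ l l' : List ℕ,
      wordSize (l.zipWith (fun a b => min (a + c) b) l') ≤ wordSize l' := by
    intro l
    induction l with
    | nil => intro l'; cases l' <;> simp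
    | cons a l ih =>
      intro l'
      cases l' with
      | nil => simp
      | cons b l' =>
        have h₁ := ih l'
        have h₂ := wordSize_nat_mono (min_le_right (a + c) b)
        simp
        omega
  have h₁ := key (t ++ w.map fun _ => 0) ((w.map fun _ => M) ++ t)
  have h₂ := wordSize_append (w.map fun _ => M) t
  unfold tableStep
  omega

/-- The table of the dynamic program. -/
def table (X : List ℕ) (bgt : ℕ) (v : List (List ℕ × ℕ)) : List ℕ :=
  v.foldr (fun p t => tableStep (bgt + 1) (disagreements X p.1) p.2 t) []

@[fun_prop]
theorem PolyTime.table {f : α → List ℕ} {g : α → ℕ} {h : α → List (List ℕ × ℕ)}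
    (hf : PolyTime f) (hg : PolyTime g) (hh : PolyTime h) :
    PolyTime fun a => table (f a) (g a) (h a) := by
  refine PolyTime.comp
    (g := fun p : List ℕ × ℕ × List (List ℕ × ℕ) => _root_.table p.1 p.2.1 p.2.2) ?_
    (hf.prodMk (hg.prodMk hh))
  have hw : PolyTime fun p : (List ℕ × ℕ × List (List ℕ × ℕ)) × (List ℕ × ℕ) =>
      (_root_.disagreements p.1.1 p.2.1).map fun _ => p.1.2.1 + 1 :=
    list_map (l := fun p : (List ℕ × ℕ × List (List ℕ × ℕ)) × (List ℕ × ℕ) =>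
      _root_.disagreements p.1.1 p.2.1) (f := fun p _ => p.1.2.1 + 1) (by fun_prop) (by fun_prop)
  have hz : PolyTime fun p : (List ℕ × ℕ × List (List ℕ × ℕ)) × (List ℕ × ℕ) =>
      (_root_.disagreements p.1.1 p.2.1).map fun _ => 0 :=
    list_map (l := fun p : (List ℕ × ℕ × List (List ℕ × ℕ)) × (List ℕ × ℕ) =>
      _root_.disagreements p.1.1 p.2.1) (f := fun p _ => 0) (by fun_prop) (by fun_prop)
  obtain ⟨q, hq⟩ := hw.wordSize_le
  have he : PolyTime fun p : (List ℕ × ℕ × List (List ℕ × ℕ)) × (List ℕ × ℕ) × List ℕ =>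
      (p.1, p.2.1) := by fun_prop
  have hw' := hw.comp he
  have hz' := hz.comp he
  refine foldr_of_step_le (l := fun p : List ℕ × ℕ × List (List ℕ × ℕ) => p.2.2)
    (init := fun _ => []) (step := fun x p t =>
      tableStep (x.2.1 + 1) (_root_.disagreements x.1 p.1) p.2 t) (by fun_prop) (by fun_prop) ?_
    -- The voter `p` is an entry of the input `x`, so the pair `(x, p)` has at most twice the size
    -- of `x`, plus one.
    (q.comp (2 * Polynomial.X + 1)) fun x t p hp => ?_
  · exact list_zipWith (l := fun p : (List ℕ × ℕ × List (List ℕ × ℕ)) × (List ℕ × ℕ) × List ℕ =>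
        p.2.2 ++ (_root_.disagreements p.1.1 p.2.1.1).map fun _ => 0)
      (l' := fun p => ((_root_.disagreements p.1.1 p.2.1.1).map fun _ => p.1.2.1 + 1) ++ p.2.2)
      (f := fun p a b => min (a + p.2.1.2) b) (by fun_prop) (by fun_prop) (by fun_prop)
  · refine (wordSize_tableStep_le _ _ _ _).trans (Nat.add_le_add_left ?_ _)
    refine (hq (x, p)).trans ?_
    rw [Polynomial.eval_comp]
    refine q.eval_nat_mono ?_
    have := wordSize_le_of_mem hp
    obtain ⟨x, y, z⟩ := x
    simp at this ⊢
    omega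

-- The index is in binary and may be far larger than the list, so the time must depend on the list:
-- positions are counted upwards along it and compared with the index.
@[fun_prop]
theorem PolyTime.list_getD {f : α → List ℕ} {g : α → ℕ} (hf : PolyTime f) (hg : PolyTime g) :
    PolyTime fun a => (f a).getD (g a) 0 := by
  refine PolyTime.comp (g := fun p : List ℕ × ℕ => p.1.getD p.2 0) ?_ (hf.prodMk hg)
  have h := foldl_of_step_le (l := fun p : List ℕ × ℕ => p.1) (init := fun _ => (0, 0))
    (step := fun p s a => (s.1 + 1, cond (decide (s.1 = p.2)) a s.2)) (by fun_prop) (by fun_prop)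
    (by fun_prop) (Polynomial.X + 6) fun p s a ha => by
      have h₁ := wordSize_le_of_mem ha
      -- The successor of `i` is at most `2 * i + 1`, which has at most one digit more than `i`.
      have h₂ := (wordSize_nat_mono (m := s.1 + 1) (n := Nat.bit true s.1)
        (by rw [Nat.bit_val]; simp; omega)).trans (PolyTime.wordSize_bit_le true s.1)
      obtain ⟨l, k⟩ := p
      obtain ⟨i, v⟩ := s
      simp at h₁ h₂ ⊢
      cases decide (i = k) <;> simp <;> omega
  refine (PolyTime.snd.comp h).congr fun p => ?_
  have key : ∀ (l : List ℕ) (i v : ℕ), (l.foldl (fun (s : ℕ × ℕ) a =>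
      (s.1 + 1, cond (decide (s.1 = p.2)) a s.2)) (i, v)).2
        = if p.2 < i then v else l.getD (p.2 - i) v := by
    intro l
    induction l with
    | nil => intro i v; simp
    | cons a l ih =>
      intro i v
      rw [List.foldl_cons, ih]
      rcases lt_trichotomy p.2 i with h | h | h
      · have : i ≠ p.2 := by omega
        simp [h, this, Nat.lt_succ_of_lt h]
      · simp [h]
      · have h₁ : i ≠ p.2 := by omega
        have h₂ : ¬ p.2 < i + 1 := by omega
        have h₃ : ¬ p.2 < i := by omega
        have h₄ : p.2 - i = (p.2 - (i + 1)) + 1 := by omega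
        simp only [h₁, h₂, h₃, if_false, decide_false, cond_false]
        rw [h₄, List.getD_cons_succ]
  rw [key]
  simp

/-- The rankings with their prices, read off from the segments that follow the first ranking. -/
def readVoters (s : List (List (List Bool))) : List (List ℕ × ℕ) :=
  -- A price ends with a comma, not a semicolon. So it is the first word of the segment that goes on
  -- with the next ranking; after the last price this rest is empty and `zipWith` discards it.
  (s.headD [] :: s.tail.map List.tail).zipWith
    (fun r c => (r.map fun w => w.foldr Nat.bit 0, (c.headD []).foldr Nat.bit 0)) s.tail

@[fun_prop]
theorem PolyTime.readVoters {f : α → List (List (List Bool))} (hf : PolyTime f) :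
    PolyTime fun a => readVoters (f a) := by
  have ht : PolyTime fun a => (f a).tail.map List.tail :=
    list_map (f := fun _ => List.tail) hf.list_tail (by fun_prop)
  have hm : PolyTime fun p : α × List (List Bool) × List (List Bool) =>
      p.2.1.map fun w => w.foldr Nat.bit 0 :=
    list_map (l := fun p : α × List (List Bool) × List (List Bool) => p.2.1)
      (f := fun _ w => w.foldr Nat.bit 0) (by fun_prop) (by fun_prop)
  exact list_zipWith (l := fun a => (f a).headD [] :: (f a).tail.map List.tail)
    (l' := fun a => (f a).tail) (f := fun _ (r c : List (List Bool)) =>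
    (r.map fun w => w.foldr Nat.bit 0, (c.headD []).foldr Nat.bit 0)) (by fun_prop) (by fun_prop)
    (by fun_prop)

/-- Decide the problem for the input that is split into a first segment, a second one that begins
with the budget and the bound, and further segments. -/
def solveSegments (x y : List (List Bool)) (z : List (List (List Bool))) : Bool :=
  -- The second word of `y` is the bound, and its first digit is the sign; a negative bound is never
  -- met.
  !((y.tail.headD []).headD false) &&
    decide ((table (x.map fun w => w.foldr Nat.bit 0) ((y.headD []).foldr Nat.bit 0)
      (readVoters (y.tail.tail :: z))).getD ((y.tail.headD []).tail.foldr Nat.bit 0) 0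
        ≤ (y.headD []).foldr Nat.bit 0)

/-- Decide the problem. -/
def solve (l : List Letter) : Bool :=
  solveSegments ((segments l).headD []) ((segments l).tail.headD []) (segments l).tail.tail

theorem polyTime_solve : PolyTime solve := by
  have h₁ : PolyTime fun l => segments l := PolyTime.id.segments
  have h₂ : PolyTime fun l => ((segments l).headD []).map fun w => w.foldr Nat.bit 0 :=
    PolyTime.list_map (f := fun _ (w : List Bool) => w.foldr Nat.bit 0) (by fun_prop) (by fun_prop)
  unfold solve solveSegments
  fun_prop

end Algorithm

/-! ### Correctness of the parser. -/

open KemenyEncoding (encNat encInt encList rankingList)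

section Parsing

theorem foldr_encodeNat (n : ℕ) : (Computability.encodeNat n).foldr Nat.bit 0 = n := by
  have key : ∀ p : PosNum, (Computability.encodePosNum p).foldr Nat.bit 0 = (p : ℕ) := by
    intro p
    induction p with
    | one => rfl
    | bit1 p ih => simp [Computability.encodePosNum, ih, Nat.bit_val]; omega
    | bit0 p ih => simp [Computability.encodePosNum, ih, Nat.bit_val]; omega
  have h : ∀ m : Num, (Computability.encodeNum m).foldr Nat.bit 0 = (m : ℕ) := by
    intro m
    cases m with
    | zero => rfl
    | pos p => exact key p
  rw [Computability.encodeNat, h]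
  exact Num.to_of_nat n

theorem segments_bit (b : Bool) (l : List Letter) :
    segments (.bit b :: l) = ((b :: ((segments l).headD []).headD []) ::
      ((segments l).headD []).tail) :: (segments l).tail := rfl

theorem segments_comma (l : List Letter) :
    segments (.comma :: l) = ([] :: (segments l).headD []) :: (segments l).tail := rfl

theorem segments_semicolon (l : List Letter) : segments (.semicolon :: l) = [] :: segments l := rfl

theorem segments_word (w : List Bool) (l : List Letter) :
    segments (w.map Letter.bit ++ Letter.comma :: l)
      = (w :: (segments l).headD []) :: (segments l).tail := by
  induction w with
  | nil => exact segments_comma l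
  | cons b w ih =>
    rw [List.map_cons, List.cons_append, segments_bit, ih]
    rfl

theorem segments_encNat (n : ℕ) (l : List Letter) :
    segments (encNat n ++ l)
      = (Computability.encodeNat n :: (segments l).headD []) :: (segments l).tail := by
  rw [encNat, List.append_assoc]
  exact segments_word _ l

theorem segments_encInt (k : ℤ) (l : List Letter) :
    segments (encInt k ++ l) = ((decide (k < 0) :: Computability.encodeNat k.natAbs) ::
      (segments l).headD []) :: (segments l).tail := by
  rw [encInt, List.cons_append, segments_bit, segments_encNat]
  rfl

theorem segments_encList (x : List ℕ) (l : List Letter) :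
    segments (encList x ++ l) = x.map Computability.encodeNat :: segments l := by
  induction x with
  | nil => exact segments_semicolon l
  | cons a x ih =>
    have : encList (a :: x) ++ l = encNat a ++ (encList x ++ l) := by simp [encList]
    rw [this, segments_encNat, ih]
    rfl

theorem map_foldr_encodeNat (x : List ℕ) :
    (x.map Computability.encodeNat).map (fun w => w.foldr Nat.bit 0) = x := by
  rw [List.map_map]
  exact (List.map_congr_left fun n _ => foldr_encodeNat n).trans (List.map_id x)

theorem readVoters_segments (v : List (List ℕ × ℕ)) :
    readVoters (segments (v.flatMap fun p => encList p.1 ++ encNat p.2)) = v := by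
  induction v with
  | nil => rfl
  | cons p v ih =>
    rw [List.flatMap_cons, List.append_assoc, segments_encList, segments_encNat]
    generalize segments (v.flatMap fun p => encList p.1 ++ encNat p.2) = s at ih
    have : readVoters (p.1.map Computability.encodeNat ::
        (Computability.encodeNat p.2 :: s.headD []) :: s.tail)
        = ((p.1.map Computability.encodeNat).map (fun w => w.foldr Nat.bit 0),
            (Computability.encodeNat p.2).foldr Nat.bit 0) :: readVoters s := rfl
    rw [this, map_foldr_encodeNat, foldr_encodeNat, ih]

theorem solve_encode (I : DollarBribery) :
    solve (KemenyEncoding.encode I) = (!decide (I.k < 0) &&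
      decide ((table (rankingList I.X) I.bgt
        (List.ofFn fun i => (rankingList (I.R i), I.cost i))).getD I.k.natAbs 0 ≤ I.bgt)) := by
  have h := readVoters_segments (List.ofFn fun i => (rankingList (I.R i), I.cost i))
  unfold solve KemenyEncoding.encode
  rw [segments_encList, segments_encNat, segments_encInt]
  generalize segments ((List.ofFn fun i => (rankingList (I.R i), I.cost i)).flatMap
    fun p => encList p.1 ++ encNat p.2) = s at h
  have e : readVoters (s.headD [] :: s.tail) = readVoters s := rfl
  simp only [solveSegments, List.headD_cons, List.tail_cons, map_foldr_encodeNat, foldr_encodeNat,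
    e, h]

end Parsing

/-! ### The Kendall tau distance as the length of a list. -/

section Distance

theorem occursBefore_ofFn {m : ℕ} (f : Fin m → ℕ) (hf : Function.Injective f) (i j : Fin m) :
    occursBefore (List.ofFn f) (f i) (f j) = decide (i < j) := by
  induction m with
  | zero => exact i.elim0
  | succ m ih =>
    have hs : Function.Injective fun i : Fin m => f i.succ :=
      hf.comp (Fin.succ_injective m)
    rw [List.ofFn_succ]
    have h : ∀ (r x y : ℕ) (l : List ℕ), occursBefore (r :: l) x y
        = cond (decide (r = y)) false (cond (decide (r = x)) true (occursBefore l x y)) :=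
      fun _ _ _ _ => rfl
    rw [h]
    simp only [hf.eq_iff]
    cases j using Fin.cases with
    | zero => simp
    | succ j =>
      cases i using Fin.cases with
      | zero => simp [(Fin.succ_ne_zero j).symm]
      | succ i =>
        simpa [(Fin.succ_ne_zero j).symm, (Fin.succ_ne_zero i).symm] using ih _ hs i j

theorem occursBefore_rankingList {m : ℕ} (π : Ranking m) (x y : Fin m) :
    occursBefore (rankingList π) x y = decide (π.symm x < π.symm y) := by
  have := occursBefore_ofFn (fun i => (π i : ℕ)) (Fin.val_injective.comp π.injective)
    (π.symm x) (π.symm y)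
  rw [Equiv.apply_symm_apply, Equiv.apply_symm_apply] at this
  exact this

theorem sum_map_rankingList {m : ℕ} (π : Ranking m) (g : ℕ → ℕ) :
    ((rankingList π).map g).sum = ∑ x : Fin m, g x := by
  rw [rankingList, List.map_ofFn, List.sum_ofFn]
  exact Equiv.sum_comp π fun x : Fin m => g x

theorem length_disagreements {m : ℕ} (π π' : Ranking m) :
    (disagreements (rankingList π) (rankingList π')).length
      = (Finset.univ.filter fun p : Fin m × Fin m =>
          π.symm p.1 < π.symm p.2 ∧ π'.symm p.2 < π'.symm p.1).card := by
  have h₁ : ∀ x : Fin m, ((rankingList π).filter fun y => occursBefore (rankingList π) x y &&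
      occursBefore (rankingList π') y x).length
      = ∑ y, if π.symm x < π.symm y ∧ π'.symm y < π'.symm x then 1 else 0 := by
    intro x
    have : ∀ l : List ℕ, ∀ p : ℕ → Bool, l.countP p = (l.map fun y => if p y then 1 else 0).sum := by
      intro l p
      induction l with
      | nil => rfl
      | cons a l ih => rw [List.countP_cons, ih, List.map_cons, List.sum_cons, add_comm]
    rw [← List.countP_eq_length_filter, this, sum_map_rankingList]
    simp only [occursBefore_rankingList, Bool.and_eq_true, decide_eq_true_eq]
  rw [disagreements, List.length_flatMap, sum_map_rankingList, Finset.card_filter,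
    Fintype.sum_prod_type]
  exact Finset.sum_congr rfl fun x _ => h₁ x

/-- Every unordered pair on which the rankings disagree has exactly one orientation that agrees with
`π`. -/
theorem kendallTau_eq {m : ℕ} (π π' : Ranking m) :
    kendallTau π π' = (disagreements (rankingList π) (rankingList π')).length := by
  classical
  rw [length_disagreements, kendallTau]
  symm
  refine Finset.card_nbij (fun p => {p.1, p.2}) ?_ ?_ ?_
  · rintro ⟨x, y⟩ h
    simp only [Finset.coe_filter, Finset.mem_univ, true_and, Set.mem_ofPred_eq] at h ⊢
    simpa using ⟨x, y, rfl, Or.inl h⟩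
  · rintro ⟨x, y⟩ h ⟨x', y'⟩ h' e
    simp only [Finset.coe_filter, Finset.mem_univ, true_and, Set.mem_ofPred_eq] at h h'
    have e' : ({x, y} : Finset (Fin m)) = {x', y'} := e
    have hx : x ∈ ({x', y'} : Finset (Fin m)) := e' ▸ by simp
    have hy : y ∈ ({x', y'} : Finset (Fin m)) := e' ▸ by simp
    simp only [Finset.mem_insert, Finset.mem_singleton] at hx hy
    rcases hx with rfl | rfl <;> rcases hy with rfl | rfl
    · exact absurd h.1 (lt_irrefl _)
    · rfl
    · exact absurd (h.1.trans h'.1) (lt_irrefl _)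
    · exact absurd h.1 (lt_irrefl _)
  · intro s hs
    simp only [Finset.coe_filter, Finset.mem_univ, true_and, Set.mem_ofPred_eq] at hs
    obtain ⟨x, y, rfl, h | h⟩ := hs
    · exact ⟨(x, y), by simpa [Ranking.Before] using h, rfl⟩
    · exact ⟨(y, x), by simpa [Ranking.Before] using h, Finset.pair_comm y x⟩

theorem kendallTau_self {m : ℕ} (π : Ranking m) : kendallTau π π = 0 := by
  rw [kendallTau_eq, length_disagreements, Finset.card_eq_zero, Finset.filter_eq_empty_iff]
  exact fun p _ h => lt_asymm h.1 h.2

end Distance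

/-! ### Correctness of the dynamic program. -/

section Table

/-- Only comparisons with thresholds `B < M` are described, and for these the cap `M` acts as
infinity. -/
theorem getD_tableStep_le_iff {M c B d : ℕ} {w t : List ℕ} (hB : B < M) :
    (tableStep M w c t).getD d 0 ≤ B ↔
      t.getD d 0 + c ≤ B ∨ (w.length ≤ d ∧ t.getD (d - w.length) 0 ≤ B) := by
  have h₁ : ∀ a : ℕ, d < t.length + w.length →
      (t ++ w.map fun _ => 0)[d]? = some (t.getD d 0) := by
    intro _ h
    rw [List.getElem?_append, List.getD_eq_getElem?_getD]
    split_ifs with h'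
    · simp [h']
    · have : d - t.length < w.length := by omega
      simp [this, List.getElem?_eq_none (not_lt.1 h')]
  have h₂ : d < t.length + w.length → ((w.map fun _ => M) ++ t)[d]?
      = some (if d < w.length then M else t.getD (d - w.length) 0) := by
    intro h
    rw [List.getElem?_append, List.getD_eq_getElem?_getD]
    simp only [List.length_map]
    split_ifs with h'
    · simp [h']
    · have : d - w.length < t.length := by omega
      simp [this]
  by_cases h : d < t.length + w.length
  · rw [List.getD_eq_getElem?_getD, tableStep, List.getElem?_zipWith, h₁ 0 h, h₂ h]
    simp only [Option.getD_some, min_le_iff]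
    split_ifs with h'
    · have : ¬ w.length ≤ d := by omega
      have : ¬ M ≤ B := by omega
      tauto
    · have : w.length ≤ d := by omega
      tauto
  · have h₃ : (tableStep M w c t).getD d 0 = 0 := by
      apply List.getD_eq_default
      simp [tableStep]
      omega
    have h₄ : t.getD (d - w.length) 0 = 0 := by
      apply List.getD_eq_default
      omega
    rw [h₃, h₄]
    have : w.length ≤ d := by omega
    simp [this]

/-- Induction on the voters: buying the first one lowers the threshold `B` by its price, keeping it
lowers `d` by its distance. Hence both are general, and `B ≤ bgt` is preserved. -/
theorem getD_table_le_iff (X : List ℕ) (bgt : ℕ) {n : ℕ} (R : Fin n → List ℕ) (c : Fin n → ℕ)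
    (d B : ℕ) (hB : B ≤ bgt) :
    (table X bgt (List.ofFn fun i => (R i, c i))).getD d 0 ≤ B ↔
      ∃ b : Fin n → Bool, (∑ i, if b i then c i else 0) ≤ B ∧
        (∑ i, if b i then 0 else (disagreements X (R i)).length) ≤ d := by
  induction n generalizing d B with
  | zero => simp [table]
  | succ n ih =>
    have h : table X bgt (List.ofFn fun i => (R i, c i)) = tableStep (bgt + 1)
        (disagreements X (R 0)) (c 0) (table X bgt (List.ofFn fun i : Fin n =>
          (R i.succ, c i.succ))) := by
      rw [List.ofFn_succ]; rfl
    rw [h, getD_tableStep_le_iff (by omega), Fin.exists_fin_succ_pi]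
    simp only [Fin.sum_univ_succ, Fin.cons_zero, Fin.cons_succ, Bool.exists_bool, if_true,
      Bool.false_eq_true, if_false, zero_add]
    rw [or_comm]
    refine or_congr ?_ ?_
    · by_cases hd : (disagreements X (R 0)).length ≤ d
      · rw [ih (fun i => R i.succ) (fun i => c i.succ) _ _ hB]
        simp only [hd, true_and]
        refine exists_congr fun b => and_congr Iff.rfl ?_
        omega
      · simp only [hd, false_and, false_iff]
        rintro ⟨b, -, h⟩
        omega
    · by_cases hc : c 0 ≤ B
      · rw [show ∀ a, a + c 0 ≤ B ↔ a ≤ B - c 0 by omega,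
          ih (fun i => R i.succ) (fun i => c i.succ) _ _ (by omega)]
        refine exists_congr fun b => and_congr ?_ Iff.rfl
        omega
      · refine ⟨fun h => absurd h (by omega), ?_⟩
        rintro ⟨b, h, -⟩
        omega

end Table

/-! ### Reduction to the choice of a subset, and the theorem. -/

/-- Replacing a ranking by `X` brings its distance down to 0, so no other replacement has to be
considered. -/
theorem DollarBribery.isYes_iff (I : DollarBribery) :
    I.IsYes ↔ ∃ b : Fin I.n → Bool, (∑ i, if b i then I.cost i else 0) ≤ I.bgt ∧
      ((∑ i, if b i then 0 else kendallTau I.X (I.R i) : ℕ) : ℤ) ≤ I.k := by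
  constructor
  · rintro ⟨S, R', hR, hc, hk⟩
    refine ⟨fun i => decide (i ∈ S), by simpa [Finset.sum_ite_mem] using hc, le_trans ?_ hk⟩
    rw [Nat.cast_le]
    refine Finset.sum_le_sum fun i _ => ?_
    by_cases hi : i ∈ S
    · simp [hi]
    · simp [hi, hR i hi]
  · rintro ⟨b, hc, hk⟩
    refine ⟨Finset.univ.filter fun i => b i, fun i => if b i then I.X else I.R i, fun i hi => ?_,
      by rwa [Finset.sum_filter], le_of_eq_of_le ?_ hk⟩
    · have : b i = false := by simpa using hi
      simp [this]
    · rw [Nat.cast_inj]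
      refine Finset.sum_congr rfl fun i _ => ?_
      cases h : b i <;> simp [h, kendallTau_self]

theorem solve_encode_iff (I : DollarBribery) :
    solve (KemenyEncoding.encode I) = true ↔ I.IsYes := by
  rw [solve_encode, DollarBribery.isYes_iff, Bool.and_eq_true, decide_eq_true_eq,
    getD_table_le_iff _ _ _ _ _ _ le_rfl]
  simp only [kendallTau_eq, Bool.not_eq_eq_eq_not, Bool.not_true, decide_eq_false_iff_not, not_lt]
  constructor
  · rintro ⟨hk, b, h₁, h₂⟩
    exact ⟨b, h₁, by omega⟩
  · rintro ⟨b, h₁, h₂⟩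
    exact ⟨by omega, b, h₁, by omega⟩

theorem mainTheorem2 :
    SolvableInPolyTime KemenyEncoding.encode DollarBribery.IsYes :=
  polyTime_solve.solvable solve_encode_iff
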